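/- Let $\mathbb H_1=\{(a,b,c)\in\mathbb R^3\}$ be the Heisenberg group with law $(a,b,c)(a',b',c')=(a+a',b+b',c+c'+ab')$, let $\Gamma$ be its subgroup of elements with integer coordinates, and let $M=\Gamma\backslash\mathbb H_1$, with the measure that is $da\,db\,dc$ on the fundamental domain $[0,1)^3$. The left-invariant vector fields $A=\partial_a$ and $B=\partial_b+a\partial_c$ descend to vector fields $A_M,B_M$ on $M$; the sub-Laplacian of $M$ is $\mathcal L_M=-(A_M^2+B_M^2)$. For $\lambda\in\mathbb Z$ put $$L^2_\lambda(M)=\{f\in L^2(M): f(\Gamma(a,b,c))=f(\Gamma(a,b,0))\,e^{2\pi i\lambda c}\}.$$ For $\omega=(\omega_1,\omega_2)\in\mathbb Z^2$ let $\chi_\omega(\Gamma(a,b,c))=e^{2\pi i(\omega_1a+\omega_2b)}$. For $\ell\in\mathbb N_0$ and $\lambda\in\mathbb Z\setminus\{0\}$ let $h_{\ell,\lambda}(u)=(2\pi|\lambda|)^{1/4}h_\ell(\sqrt{2\pi|\lambda|}\,u)$, where $h_\ell(u)=(\sqrt\pi\,2^\ell\,\ell!)^{-1/2}H_\ell(u)e^{-u^2/2}$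 and $H_\ell(u)=(-1)^\ell e^{u^2}\frac{d^\ell}{du^\ell}e^{-u^2}$. For $\lambda\in\mathbb Z\setminus\{0\}$, $q\in\mathbb Z/\lambda\mathbb Z$ and $\ell\in\mathbb N_0$ let $$h_{\lambda,q,\ell}(\Gamma(a,b,c))=\frac{\sqrt{|\lambda|}}{\lambda}\sum_{k\in\mathbb Z}e^{-2\pi iqk/\lambda}\,e^{2\pi i(\lambda c+kb)}\,h_{\ell,\lambda}\Big(\frac k\lambda+a\Big).$$ This is the Berezin–Weil–Zak transform $\mathrm{BWZ}_{\lambda,q}h_{\ell,\lambda}$; it is well defined on $M$ and depends only on the class of $q$ modulo $\lambda$. **Theorem.** The series above converge absolutely. The functions $\chi_\omega$ $(\omega\in\mathbb Z^2)$ and $h_{\lambda,q,\ell}$ $(\lambda\in\mathbb Z\setminus\{0\},\ q\in\mathbb Z/\lambda\mathbb Z,\ \ell\in\mathbb N_0)$ are smooth on $M$, satisfy $\|\chi_\omega\|_{L^2(M)}=1$ and $\|h_{\lambda,q,\ell}\|_{L^2(M)}=1$, and are eigenfunctions of $\mathcal L_M$: $$\mathcal L_M\chi_\omega=(2\pi)^2|\omega|^2\chi_\omega,\qquad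 \mathcal L_Mh_{\lambda,q,\ell}=2\pi|\lambda|(2\ell+1)\,h_{\lambda,q,\ell}.$$ Moreover $L^2(M)=\bigoplus^\perp_{\lambda\in\mathbb Z}L^2_\lambda(M)$ (orthogonal Hilbert sum), and all these functions together form an orthonormal basis of $L^2(M)$. More precisely, $(\chi_\omega)_{\omega\in\mathbb Z^2}$ is an orthonormal basis of $L^2_0(M)$ and, for each $\lambda\in\mathbb Z\setminus\{0\}$, $(h_{\lambda,q,\ell})_{q\in\mathbb Z/\lambda\mathbb Z,\ \ell\in\mathbb N_0}$ is an orthonormal basis of $L^2_\lambda(M)$. -/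

import Mathlib

namespace HeisenbergNil

/-! ### The Heisenberg group and its standard nilmanifold -/

/-- The three-dimensional Heisenberg group, in the coordinates `(a, b, c)` of the upper triangular
unipotent real matrix with rows `(1, a, c)`, `(0, 1, b)`, `(0, 0, 1)`. -/
@[ext]
structure Heis where
  a : ℝ
  b : ℝ
  c : ℝ

namespace Heis

/-- The group law `(a,b,c)(a',b',c') = (a+a', b+b', c+c'+ab')`. -/
instance : Mul Heis := ⟨fun x y => ⟨x.a + y.a, x.b + y.b, x.c + y.c + x.a * y.b⟩⟩
instance : One Heis := ⟨⟨0, 0, 0⟩⟩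
instance : Inv Heis := ⟨fun x => ⟨-x.a, -x.b, -x.c + x.a * x.b⟩⟩

@[simp] lemma mul_a (x y : Heis) : (x * y).a = x.a + y.a := rfl
@[simp] lemma mul_b (x y : Heis) : (x * y).b = x.b + y.b := rfl
@[simp] lemma mul_c (x y : Heis) : (x * y).c = x.c + y.c + x.a * y.b := rfl
@[simp] lemma one_a : (1 : Heis).a = 0 := rfl
@[simp] lemma one_b : (1 : Heis).b = 0 := rfl
@[simp] lemma one_c : (1 : Heis).c = 0 := rfl
@[simp] lemma inv_a (x : Heis) : (x⁻¹).a = -x.a := rfl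
@[simp] lemma inv_b (x : Heis) : (x⁻¹).b = -x.b := rfl
@[simp] lemma inv_c (x : Heis) : (x⁻¹).c = -x.c + x.a * x.b := rfl

instance : Group Heis :=
  Group.ofLeftAxioms
    (fun x y z => by ext <;> simp <;> ring)
    (fun x => by ext <;> simp)
    (fun x => by ext <;> simp)

/-- The global coordinates identifying the group with `ℝ³`. -/
def coord : Heis ≃ ℝ × ℝ × ℝ where
  toFun x := (x.a, x.b, x.c)
  invFun p := ⟨p.1, p.2.1, p.2.2⟩
  left_inv _ := rfl
  right_inv _ := rfl

/-- The Borel structure of `ℝ³`. -/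
instance : MeasurableSpace Heis := MeasurableSpace.comap coord inferInstance

/-- The Haar measure `da db dc`. -/
noncomputable def haar : MeasureTheory.Measure Heis :=
  (MeasureTheory.volume : MeasureTheory.Measure (ℝ × ℝ × ℝ)).map coord.symm

end Heis

/-- The discrete subgroup of the elements with integer coordinates. -/
def Gam : Subgroup Heis where
  carrier := {x | ∃ m n p : ℤ, x = ⟨m, n, p⟩}
  one_mem' := ⟨0, 0, 0, by ext <;> simp⟩
  mul_mem' := by
    rintro _ _ ⟨m, n, p, rfl⟩ ⟨m', n', p', rfl⟩
    exact ⟨m + m', n + n', p + p' + m * n', by ext <;> simp⟩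
  inv_mem' := by
    rintro _ ⟨m, n, p, rfl⟩
    exact ⟨-m, -n, -p + m * n, by ext <;> simp⟩

/-- The Heisenberg nilmanifold `M = Γ \ H`: the set of the classes `Γ x`. Its σ-algebra is the
quotient one. -/
abbrev Nil : Type := Quotient (QuotientGroup.rightRel Gam)

/-- The canonical projection `x ↦ Γ x`. -/
def proj (x : Heis) : Nil := Quotient.mk (QuotientGroup.rightRel Gam) x

/-- The fundamental domain `[0,1)³`. -/
def fundDomain : Set Heis :=
  {x | x.a ∈ Set.Ico (0 : ℝ) 1 ∧ x.b ∈ Set.Ico (0 : ℝ) 1 ∧ x.c ∈ Set.Ico (0 : ℝ) 1}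

/-- The measure of `M` induced by the Haar measure `da db dc` of the group and the counting measure
of `Γ`: it is `da db dc` on the fundamental domain `[0,1)³`. -/
noncomputable def nilMeasure : MeasureTheory.Measure Nil :=
  (Heis.haar.restrict fundDomain).map proj

/-- The Hilbert space `L²(M)`. -/
noncomputable abbrev L2M : Type := MeasureTheory.Lp ℂ 2 nilMeasure

/-- Descent to `M` of a function on the group that is invariant under left multiplication
by `Γ`. -/
def descend (φ : Heis → ℂ)
    (hφ : ∀ (m n p : ℤ) (x : Heis), φ ((⟨m, n, p⟩ : Heis) * x) = φ x) : Nil → ℂ :=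
  Quotient.lift φ (by
    intro x y hxy
    obtain ⟨m, n, p, h⟩ := QuotientGroup.rightRel_apply.mp hxy
    have hy : y = (⟨m, n, p⟩ : Heis) * x := by rw [← h]; group
    rw [hy, hφ])

/-- Smooth functions on `M`. The projection of the group onto `M` is a local diffeomorphism, hence a
function on `M` is smooth exactly when its `Γ`-periodic lift to the group is a smooth function of
the coordinates `(a, b, c)`. -/
def IsSmooth (F : Nil → ℂ) : Prop :=
  ContDiff ℝ ((⊤ : ℕ∞) : WithTop ℕ∞) (fun p : ℝ × ℝ × ℝ => F (proj (Heis.coord.symm p)))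

/-! ### Left-invariant vector fields and the sub-Laplacian -/

/-- The right translation `Γ x ↦ Γ x g` of `M`. -/
def rightTranslate (p : Nil) (g : Heis) : Nil :=
  Quotient.map (fun x => x * g) (by
    intro x y hxy
    have h := QuotientGroup.rightRel_apply.mp hxy
    exact QuotientGroup.rightRel_apply.mpr (by simpa [mul_assoc] using h)) p

/-- The vector field of `M` that comes from the left-invariant vector field `A = ∂_a`:
`A_M F (Γ x) = d/dt F (Γ x exp(tA))` at `t = 0`, with `exp(tA) = (t, 0, 0)`. -/
noncomputable def fieldA (F : Nil → ℂ) (p : Nil) : ℂ :=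
  deriv (fun t : ℝ => F (rightTranslate p ⟨t, 0, 0⟩)) 0

/-- The vector field of `M` that comes from the left-invariant vector field `B = ∂_b + a ∂_c`:
`B_M F (Γ x) = d/dt F (Γ x exp(tB))` at `t = 0`, with `exp(tB) = (0, t, 0)`. -/
noncomputable def fieldB (F : Nil → ℂ) (p : Nil) : ℂ :=
  deriv (fun t : ℝ => F (rightTranslate p ⟨0, t, 0⟩)) 0

/-- The sub-Laplacian `L_M = -(A_M² + B_M²)`, acting on (smooth) functions on `M`. -/
noncomputable def subLaplacian (F : Nil → ℂ) (p : Nil) : ℂ :=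
  -(fieldA (fieldA F) p + fieldB (fieldB F) p)

/-! ### The subspaces of the Fourier decomposition in the central variable -/

/-- The subspace `L²_λ(M)` of the `f ∈ L²(M)` with `f(Γ(a,b,c)) = f(Γ(a,b,0)) e^{2πiλc}`. As `f` is
a class of functions modulo null sets, the identity is asked of one of its representatives. -/
noncomputable def L2sub (lam : ℤ) : Submodule ℂ L2M where
  carrier := {f | ∃ F : Nil → ℂ, f =ᵐ[nilMeasure] F ∧ ∀ a b c : ℝ,
    F (proj ⟨a, b, c⟩) = F (proj ⟨a, b, 0⟩) * Complex.exp (2 * Real.pi * Complex.I * lam * c)}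
  zero_mem' := ⟨0, MeasureTheory.Lp.coeFn_zero _ _ _, by simp⟩
  add_mem' := by
    rintro f g ⟨F, hF, hF'⟩ ⟨G, hG, hG'⟩
    refine ⟨F + G, (MeasureTheory.Lp.coeFn_add f g).trans (hF.add hG), fun a b c => ?_⟩
    simp only [Pi.add_apply]
    rw [hF', hG', add_mul]
  smul_mem' := by
    rintro z f ⟨F, hF, hF'⟩
    refine ⟨z • F, (MeasureTheory.Lp.coeFn_smul z f).trans (hF.const_smul z), fun a b c => ?_⟩
    simp only [Pi.smul_apply, smul_eq_mul]
    rw [hF', ← mul_assoc]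

/-! ### The characters -/

/-- The function `χ_ω(Γ(a,b,c)) = exp(2πi (ω₁ a + ω₂ b))`. -/
noncomputable def chi (ω : ℤ × ℤ) : Nil → ℂ :=
  descend (fun x => Complex.exp (2 * Real.pi * Complex.I * (ω.1 * x.a + ω.2 * x.b))) (by
    intro m n p x
    refine Complex.exp_eq_exp_iff_exists_int.mpr ⟨ω.1 * m + ω.2 * n, ?_⟩
    simp only [Heis.mul_a, Heis.mul_b]
    push_cast
    ring)

/-! ### Hermite functions -/

/-- The Hermite polynomial `H_ℓ(u) = (-1)^ℓ e^{u²} (d/du)^ℓ e^{-u²}`. -/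
noncomputable def hermiteH (l : ℕ) (u : ℝ) : ℝ :=
  (-1) ^ l * Real.exp (u ^ 2) * iteratedDeriv l (fun v : ℝ => Real.exp (-v ^ 2)) u

/-- The Hermite function `h_ℓ(u) = (√π 2^ℓ ℓ!)^{-1/2} H_ℓ(u) e^{-u²/2}`. -/
noncomputable def hermiteFun (l : ℕ) (u : ℝ) : ℝ :=
  (√Real.pi * 2 ^ l * (l.factorial : ℝ)) ^ (-(1 / 2) : ℝ) * hermiteH l u * Real.exp (-u ^ 2 / 2)

/-- The rescaled Hermite function `h_{ℓ,λ}(u) = (2π|λ|)^{1/4} h_ℓ(√(2π|λ|) u)`. -/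
noncomputable def hermiteScaled (l : ℕ) (lam : ℝ) (u : ℝ) : ℝ :=
  (2 * Real.pi * |lam|) ^ (1 / 4 : ℝ) * hermiteFun l (√(2 * Real.pi * |lam|) * u)

/-! ### The Berezin-Weil-Zak transform -/

/-- The `k`-th term `e^{-2πi q k/λ} e^{2πi(λc + kb)} h(k/λ + a)` of the series that defines the
Berezin-Weil-Zak transform of `h` at `Γ(a,b,c)`. -/
noncomputable def bwzTerm (lam q : ℤ) (h : ℝ → ℂ) (x : Heis) (k : ℤ) : ℂ :=
  Complex.exp (-(2 * Real.pi * Complex.I * q * (k / lam))) *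
    Complex.exp (2 * Real.pi * Complex.I * (lam * x.c + k * x.b)) *
    h ((k : ℝ) / (lam : ℝ) + x.a)

lemma bwzTerm_mul {lam : ℤ} (hlam : lam ≠ 0) (q : ℤ) (h : ℝ → ℂ) (m n p : ℤ) (x : Heis) (k : ℤ) :
    bwzTerm lam q h ((⟨m, n, p⟩ : Heis) * x) k = bwzTerm lam q h x (k + lam * m) := by
  have hl : (lam : ℂ) ≠ 0 := by exact_mod_cast hlam
  have hl' : (lam : ℝ) ≠ 0 := by exact_mod_cast hlam
  simp only [bwzTerm, Heis.mul_a, Heis.mul_b, Heis.mul_c]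
  have harg : (k : ℝ) / (lam : ℝ) + ((m : ℝ) + x.a)
      = ((k + lam * m : ℤ) : ℝ) / (lam : ℝ) + x.a := by
    push_cast; field_simp; ring
  rw [harg]
  congr 1
  rw [← Complex.exp_add, ← Complex.exp_add]
  refine Complex.exp_eq_exp_iff_exists_int.mpr ⟨lam * p + k * n + q * m, ?_⟩
  push_cast
  field_simp
  ring

lemma bwzTerm_add {lam : ℤ} (hlam : lam ≠ 0) (q j : ℤ) (h : ℝ → ℂ) (x : Heis) (k : ℤ) :
    bwzTerm lam (q + lam * j) h x k = bwzTerm lam q h x k := by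
  have hl : (lam : ℂ) ≠ 0 := by exact_mod_cast hlam
  simp only [bwzTerm]
  congr 2
  refine Complex.exp_eq_exp_iff_exists_int.mpr ⟨-(j * k), ?_⟩
  push_cast
  field_simp
  ring

/-- The Berezin-Weil-Zak transform of a (rapidly decaying) function `h` on the real line,
`BWZ_{λ,q}(h)(Γ(a,b,c)) = (√|λ| / λ) ∑_{k ∈ ℤ} e^{-2πi q k/λ} e^{2πi(λc + kb)} h(k/λ + a)`,
for `q ∈ ℤ` and `λ ∈ ℤ \ {0}`. -/
noncomputable def bwz (lam q : ℤ) (h : ℝ → ℂ) : Nil → ℂ :=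
  descend (fun x => ((√|(lam : ℝ)| / (lam : ℝ) : ℝ) : ℂ) * ∑' k : ℤ, bwzTerm lam q h x k) (by
    intro m n p x
    rcases eq_or_ne lam 0 with rfl | hlam
    · simp
    · simp_rw [bwzTerm_mul hlam q h m n p x]
      congr 1
      exact (Equiv.addRight (lam * m)).tsum_eq (bwzTerm lam q h x))

lemma bwz_add (lam q j : ℤ) (h : ℝ → ℂ) : bwz lam (q + lam * j) h = bwz lam q h := by
  rcases eq_or_ne lam 0 with rfl | hlam
  · simp
  · funext p
    induction p using Quotient.inductionOn with
    | h x => simp only [bwz, descend, Quotient.lift_mk, bwzTerm_add hlam q j h x]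

/-- The group `ℤ/λℤ`. -/
abbrev ZModInt (lam : ℤ) : Type := ℤ ⧸ AddSubgroup.zmultiples lam

/-- The function `h_{λ,q,ℓ} = BWZ_{λ,q} h_{ℓ,λ}` on `M`, with `q ∈ ℤ/λℤ`. -/
noncomputable def hFun (lam : ℤ) (q : ZModInt lam) (l : ℕ) : Nil → ℂ :=
  Quotient.liftOn' q (fun q₀ : ℤ => bwz lam q₀ (fun u => (hermiteScaled l lam u : ℂ))) (by
    intro q₁ q₂ hq
    obtain ⟨j, hj⟩ := AddSubgroup.mem_zmultiples_iff.mp (QuotientAddGroup.leftRel_apply.mp hq)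
    have h2 : q₂ = q₁ + lam * j := by
      rw [smul_eq_mul] at hj
      linarith
    simp only [h2, bwz_add])

/-- The index set of the functions `h_{λ,q,ℓ}`: `λ ∈ ℤ \ {0}`, `q ∈ ℤ/λℤ`, `ℓ ∈ ℕ`. -/
abbrev HIndex : Type := Σ lam : {lam : ℤ // lam ≠ 0}, ZModInt lam.1 × ℕ

end HeisenbergNil

open HeisenbergNil

namespace HeisenbergNil

open Polynomial MeasureTheory
open scoped ComplexConjugate

/-! ### Polynomials times a Gaussian -/

/-! Two one-dimensional facts carry the theorem: the Hermite functions are an orthonormal, complete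
system of eigenfunctions of the harmonic oscillator, and the transform turns the geometry of `M`
into that of the line.

Eigenfunctions. In the `k`-th term of a transform, `∂_b` produces `2πik` and `a∂_c` produces
`2πiλa`, together `2πiλ(k/λ + a)`. So on transforms of a polynomial times `e^{-π|λ|v²}`, `A_M` acts
as `d/dv` and `B_M` as multiplication by `2πiλv` (`fieldA_gaussBwz`, `fieldB_gaussBwz`). The
sub-Laplacian becomes `-d²/dv² + (2πλ)²v²`, and Hermite's equation gives the eigenvalue
(`scaledHermitePoly_ode`). This class of series is closed under differentiation, up to the
coefficient `a`, whence smoothness (`contDiff_gaussSeries`).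

Inner products. A function on `M` is read on the cube `[0,1)³` and expanded in a Fourier series in
`(b, c)`. Pairing it with a transform gives a sum over `k` of `e^{2πiqk/λ}` times integrals over
`[0,1)` of the shifted profile against the coefficient of index `(k, λ)`
(`hasSum_integral_conj_gaussSeries`). Write `k = r + λm`: for fixed `r` the intervals `k/λ + [0,1)`
tile the line, so the sum over `m` is one integral over `ℝ`, and `q` enters only through characters
of `ℤ/λℤ`. When the other function is a transform too, orthogonality of these characters and of the
Hermite functions gives orthonormality (`integral_conj_gaussSeries_mul`).

Completeness. If `g` is orthogonal to every `h_{λ,q,ℓ}` for a fixed `λ`, inverting the characters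
isolates each `r`. The coefficients of that class, glued to one function on `ℝ`, are then orthogonal
to all Hermite functions and vanish (`fiberCoeff_ae_eq_zero`). Orthogonality to the characters `χ_ω`
handles central frequency zero, so all Fourier coefficients on the cube vanish
(`eq_zero_of_inner_eq_zero`). The statements about the spaces `L²_λ(M)` follow from totality of the
whole family and the mutual orthogonality of these spaces. -/

/-- The function `v ↦ P(v) e^{-α v²}`. -/
noncomputable def gaussPoly (α : ℝ) (P : ℝ[X]) (v : ℝ) : ℝ :=
  P.eval v * Real.exp (-α * v ^ 2)

/-- The polynomial `D P` for which `(P e^{-α v²})' = (D P) e^{-α v²}`. -/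
noncomputable def gaussDeriv (α : ℝ) (P : ℝ[X]) : ℝ[X] :=
  derivative P - C (2 * α) * X * P

lemma gaussPoly_add (α : ℝ) (P Q : ℝ[X]) (v : ℝ) :
    gaussPoly α (P + Q) v = gaussPoly α P v + gaussPoly α Q v := by
  simp only [gaussPoly, eval_add]; ring

lemma gaussPoly_sub (α : ℝ) (P Q : ℝ[X]) (v : ℝ) :
    gaussPoly α (P - Q) v = gaussPoly α P v - gaussPoly α Q v := by
  simp only [gaussPoly, eval_sub]; ring

lemma gaussPoly_C_mul (α c : ℝ) (P : ℝ[X]) (v : ℝ) :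
    gaussPoly α (C c * P) v = c * gaussPoly α P v := by
  simp only [gaussPoly, eval_mul, eval_C]; ring

lemma gaussPoly_X_mul (α : ℝ) (P : ℝ[X]) (v : ℝ) :
    gaussPoly α (X * P) v = v * gaussPoly α P v := by
  simp only [gaussPoly, eval_mul, eval_X]; ring

lemma hasDerivAt_gaussPoly (α : ℝ) (P : ℝ[X]) (v : ℝ) :
    HasDerivAt (gaussPoly α P) (gaussPoly α (gaussDeriv α P) v) v := by
  have h1 := P.hasDerivAt v
  have h2 : HasDerivAt (fun v : ℝ => Real.exp (-α * v ^ 2))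
      (Real.exp (-α * v ^ 2) * (-α * (2 * v))) v := by
    have := ((hasDerivAt_pow 2 v).const_mul (-α)).exp
    simpa using this
  refine (h1.mul h2).congr_deriv ?_
  simp only [gaussPoly, gaussDeriv, eval_sub, eval_mul, eval_C, eval_X]; ring

lemma continuous_gaussPoly (α : ℝ) (P : ℝ[X]) : Continuous (gaussPoly α P) :=
  continuous_iff_continuousAt.mpr fun v => (hasDerivAt_gaussPoly α P v).continuousAt

/-- A single term of the exponential series of `αv²` controls `v^(2n)`; passing from `|v|^n` to `1 +
v^(2n)` removes the odd powers. -/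
lemma exists_abs_pow_mul_exp_le {α : ℝ} (hα : 0 < α) (n : ℕ) :
    ∃ K : ℝ, ∀ v : ℝ, |v| ^ n * Real.exp (-α * v ^ 2) ≤ K := by
  refine ⟨1 + n.factorial / α ^ n, fun v => ?_⟩
  have h1 : |v| ^ n ≤ 1 + v ^ (2 * n) := by
    have h2 : v ^ (2 * n) = (|v| ^ n) ^ 2 := by
      rw [← pow_mul, mul_comm n 2, pow_mul, pow_mul, sq_abs]
    rw [h2]; nlinarith [sq_nonneg (|v| ^ n - 1), sq_nonneg (|v| ^ n)]
  have h3 : v ^ (2 * n) ≤ n.factorial / α ^ n * Real.exp (α * v ^ 2) := by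
    have := Real.pow_div_factorial_le_exp (x := α * v ^ 2) (by positivity) n
    rw [div_le_iff₀ (by positivity), mul_pow, ← pow_mul] at this
    rw [div_mul_eq_mul_div, le_div_iff₀ (by positivity)]
    linarith
  have h4 : Real.exp (α * v ^ 2) * Real.exp (-α * v ^ 2) = 1 := by
    rw [← Real.exp_add]; simp
  have h5 : Real.exp (-α * v ^ 2) ≤ 1 := Real.exp_le_one_iff.mpr (by nlinarith [sq_nonneg v])
  calc |v| ^ n * Real.exp (-α * v ^ 2)
      ≤ (1 + n.factorial / α ^ n * Real.exp (α * v ^ 2)) * Real.exp (-α * v ^ 2) := by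
        gcongr; linarith
    _ = Real.exp (-α * v ^ 2) + n.factorial / α ^ n := by rw [add_mul, mul_assoc, h4]; ring
    _ ≤ _ := by linarith

lemma exists_abs_gaussPoly_le {α : ℝ} (hα : 0 < α) (P : ℝ[X]) :
    ∃ K : ℝ, ∀ v : ℝ, |gaussPoly α P v| ≤ K := by
  induction P using Polynomial.induction_on' with
  | add P Q hP hQ =>
    obtain ⟨K, hK⟩ := hP
    obtain ⟨K', hK'⟩ := hQ
    refine ⟨K + K', fun v => ?_⟩
    rw [gaussPoly_add]
    exact (abs_add_le _ _).trans (add_le_add (hK v) (hK' v))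
  | monomial n c =>
    obtain ⟨K, hK⟩ := exists_abs_pow_mul_exp_le hα n
    refine ⟨|c| * K, fun v => ?_⟩
    rw [gaussPoly, eval_monomial, abs_mul, abs_mul, abs_pow, Real.abs_exp, mul_assoc]
    exact mul_le_mul_of_nonneg_left (hK v) (abs_nonneg _)

/-- A polynomial times a Gaussian decays quadratically. -/
lemma exists_abs_gaussPoly_le_inv {α : ℝ} (hα : 0 < α) (P : ℝ[X]) :
    ∃ K : ℝ, 0 ≤ K ∧ ∀ v : ℝ, |gaussPoly α P v| ≤ K * (1 + v ^ 2)⁻¹ := by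
  -- Boundedness for the polynomial `(1 + X²)P` is quadratic decay for `P`.
  obtain ⟨K, hK⟩ := exists_abs_gaussPoly_le hα ((1 + X * X) * P)
  refine ⟨K, (abs_nonneg _).trans (hK 0), fun v => ?_⟩
  rw [← div_eq_mul_inv, le_div_iff₀ (by positivity)]
  refine le_trans (le_of_eq ?_) (hK v)
  have h : gaussPoly α ((1 + X * X) * P) v = gaussPoly α P v * (1 + v ^ 2) := by
    simp only [gaussPoly, eval_add, eval_mul, eval_X, eval_one]
    ring
  rw [h, abs_mul, abs_of_pos (show 0 < 1 + v ^ 2 by positivity)]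

lemma integrable_gaussPoly {α : ℝ} (hα : 0 < α) (P : ℝ[X]) : Integrable (gaussPoly α P) := by
  obtain ⟨K, -, hK⟩ := exists_abs_gaussPoly_le_inv hα P
  exact (integrable_inv_one_add_sq.const_mul K).mono'
    (continuous_gaussPoly α P).aestronglyMeasurable (ae_of_all _ hK)

/-- The integrand is the derivative of an integrable function; this is integration by parts without
boundary terms. -/
lemma integral_gaussDeriv {α : ℝ} (hα : 0 < α) (P : ℝ[X]) :
    ∫ v, gaussPoly α (gaussDeriv α P) v = 0 :=
  integral_eq_zero_of_hasDerivAt_of_integrable (hasDerivAt_gaussPoly α P)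
    (integrable_gaussPoly hα _) (integrable_gaussPoly hα _)

/-! ### Hermite polynomials -/

/-- The physicists' Hermite polynomials. -/
noncomputable def physHermite : ℕ → ℝ[X]
  | 0 => 1
  | n + 1 => 2 * X * physHermite n - derivative (physHermite n)

lemma derivative_physHermite_succ (n : ℕ) :
    derivative (physHermite (n + 1)) = C (2 * ((n : ℝ) + 1)) * physHermite n := by
  induction n with
  | zero =>
    simp [physHermite]
    rw [← C_ofNat]
  | succ n ih =>
    have h : physHermite (n + 1) = 2 * X * physHermite n - derivative (physHermite n) := rfl
    rw [physHermite, derivative_sub, ih, derivative_mul, ih]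
    simp only [derivative_mul, derivative_X, derivative_ofNat, derivative_C]
    rw [h]
    simp only [C_mul, C_add, map_natCast, C_ofNat, map_one, Nat.cast_add, Nat.cast_one]
    ring

/-- For `n = 0` the truncated index `n - 1` is harmless, because its coefficient vanishes. The same
convention is used below. -/
lemma derivative_physHermite (n : ℕ) :
    derivative (physHermite n) = C (2 * (n : ℝ)) * physHermite (n - 1) := by
  cases n with
  | zero => simp [physHermite]
  | succ n => simpa using derivative_physHermite_succ n

/-- The defining recurrence with the derivative replaced by its value. It trades a factor `X` for a
change of index, which the completeness proof iterates. -/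
lemma X_mul_physHermite (n : ℕ) :
    X * physHermite n =
      C (1 / 2) * physHermite (n + 1) + C (n : ℝ) * physHermite (n - 1) := by
  have h := derivative_physHermite n
  have h2 : (C (1 / 2) : ℝ[X]) * C 2 = 1 := by rw [← C_mul]; simp
  rw [physHermite, h, C_mul]
  have h3 : (2 : ℝ[X]) = C 2 := (map_ofNat C 2).symm
  rw [h3]
  linear_combination (-X * physHermite n + C (n : ℝ) * physHermite (n - 1)) * h2

/-- Hermite's differential equation. -/
lemma physHermite_ode (n : ℕ) :
    derivative (derivative (physHermite n)) =
      2 * X * derivative (physHermite n) - C (2 * (n : ℝ)) * physHermite n := by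
  have h1 := derivative_physHermite_succ n
  have h2 : derivative (physHermite (n + 1))
      = 2 * physHermite n + 2 * X * derivative (physHermite n)
        - derivative (derivative (physHermite n)) := by
    rw [physHermite, derivative_sub, derivative_mul]
    simp
  rw [h2] at h1
  simp only [C_mul, C_add, map_natCast, C_ofNat, map_one] at h1 ⊢
  linear_combination -h1

/-- The recurrence defining `physHermite` says that `gaussDeriv 1` sends each polynomial of the
sequence to minus the next one. -/
lemma iteratedDeriv_gaussian (l : ℕ) :
    iteratedDeriv l (fun v : ℝ => Real.exp (-v ^ 2)) =
      fun v => (-1) ^ l * gaussPoly 1 (physHermite l) v := by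
  induction l with
  | zero => funext v; simp [gaussPoly, physHermite]
  | succ l ih =>
    funext v
    rw [iteratedDeriv_succ, ih, ((hasDerivAt_gaussPoly 1 _ v).const_mul _).deriv, physHermite]
    simp only [gaussPoly, gaussDeriv, eval_sub, eval_mul, eval_C, eval_X, eval_ofNat]
    ring

lemma hermiteH_eq (l : ℕ) (u : ℝ) : hermiteH l u = (physHermite l).eval u := by
  have h1 : ((-1 : ℝ) ^ l) * (-1) ^ l = 1 := by rw [← mul_pow]; simp
  have h2 : Real.exp (u ^ 2) * Real.exp (-1 * u ^ 2) = 1 := by rw [← Real.exp_add]; simp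
  rw [hermiteH, iteratedDeriv_gaussian]
  simp only [gaussPoly]
  linear_combination (physHermite l).eval u * (Real.exp (u ^ 2) * Real.exp (-1 * u ^ 2)) * h1
    + (physHermite l).eval u * h2

/-- Integration by parts: `H_{m+1} H_n` and `H_m H_n'` differ by the polynomial of the derivative of
`H_m H_n e^{-v²}`. -/
lemma integral_gaussPoly_physHermite_succ_mul (m n : ℕ) :
    ∫ v, gaussPoly 1 (physHermite (m + 1) * physHermite n) v =
      2 * (n : ℝ) * ∫ v, gaussPoly 1 (physHermite m * physHermite (n - 1)) v := by
  have h : physHermite (m + 1) * physHermite n =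
      C (2 * (n : ℝ)) * (physHermite m * physHermite (n - 1)) -
        gaussDeriv 1 (physHermite m * physHermite n) := by
    rw [physHermite, gaussDeriv, derivative_mul, derivative_physHermite n]
    simp only [C_mul, map_natCast, C_ofNat, map_one]
    ring
  rw [h]
  simp_rw [gaussPoly_sub, gaussPoly_C_mul]
  rw [integral_sub ((integrable_gaussPoly one_pos _).const_mul _)
    (integrable_gaussPoly one_pos _), integral_gaussDeriv one_pos, sub_zero,
    integral_const_mul]

/-- Orthogonality of the Hermite polynomials. -/
lemma integral_gaussPoly_physHermite_mul (m n : ℕ) :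
    ∫ v, gaussPoly 1 (physHermite m * physHermite n) v =
      if m = n then √Real.pi * 2 ^ n * (n.factorial : ℝ) else 0 := by
  induction m generalizing n with
  | zero =>
    cases n with
    | zero =>
      simp only [physHermite, mul_one, gaussPoly, eval_one, one_mul, if_true, pow_zero,
        Nat.factorial_zero, Nat.cast_one]
      rw [integral_gaussian]; simp
    | succ n =>
      rw [mul_comm, integral_gaussPoly_physHermite_succ_mul]
      simp
  | succ m ih =>
    rw [integral_gaussPoly_physHermite_succ_mul]
    cases n with
    | zero => simp
    | succ n =>
      rw [Nat.add_sub_cancel, ih]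
      by_cases h : m = n
      · subst h
        simp only [if_true, Nat.factorial_succ]
        push_cast; ring
      · simp [h]

/-! ### Rescaled Hermite functions -/

/-- The polynomial factor of `h_{ℓ,λ}`. -/
noncomputable def scaledHermitePoly (l : ℕ) (lam : ℝ) : ℝ[X] :=
  C ((2 * Real.pi * |lam|) ^ (1 / 4 : ℝ) *
      (√Real.pi * 2 ^ l * (l.factorial : ℝ)) ^ (-(1 / 2) : ℝ)) *
    (physHermite l).comp (C √(2 * Real.pi * |lam|) * X)

lemma hermiteScaled_eq (l : ℕ) (lam : ℝ) :
    hermiteScaled l lam = gaussPoly (Real.pi * |lam|) (scaledHermitePoly l lam) := by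
  funext u
  have hs : √(2 * Real.pi * |lam|) ^ 2 = 2 * Real.pi * |lam| := Real.sq_sqrt (by positivity)
  rw [hermiteScaled, hermiteFun, hermiteH_eq, gaussPoly, scaledHermitePoly]
  simp only [eval_mul, eval_C, eval_comp, eval_X]
  have : -(√(2 * Real.pi * |lam|) * u) ^ 2 / 2 = -(Real.pi * |lam|) * u ^ 2 := by
    rw [mul_pow, hs]; ring
  rw [this]; ring

/-- This is the eigenvalue equation of `-d²/dv² + (2πλ)²v²` with the Gaussian factor removed; it is
Hermite's equation composed with the scaling `v ↦ √(2π|λ|) v`. -/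
lemma scaledHermitePoly_ode (l : ℕ) (lam : ℝ) :
    C ((2 * (Real.pi * |lam|)) ^ 2) * (X * (X * scaledHermitePoly l lam))
      - gaussDeriv (Real.pi * |lam|) (gaussDeriv (Real.pi * |lam|) (scaledHermitePoly l lam))
      = C (2 * Real.pi * |lam| * (2 * l + 1)) * scaledHermitePoly l lam := by
  have hs : √(2 * Real.pi * |lam|) ^ 2 = 2 * (Real.pi * |lam|) := by
    rw [Real.sq_sqrt (by positivity)]; ring
  have ht : 2 * Real.pi * |lam| * (2 * l + 1) = (2 * (Real.pi * |lam|)) * (2 * l + 1) := by ring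
  rw [ht]
  unfold scaledHermitePoly gaussDeriv
  generalize (2 * Real.pi * |lam|) ^ (1 / 4 : ℝ) *
      (√Real.pi * 2 ^ l * (l.factorial : ℝ)) ^ (-(1 / 2) : ℝ) = c
  rw [← hs]
  generalize √(2 * Real.pi * |lam|) = s
  have h := congrArg (fun p : ℝ[X] => p.comp (C s * X)) (physHermite_ode l)
  simp only [sub_comp, mul_comp, C_comp, X_comp, ofNat_comp] at h
  simp only [derivative_sub, derivative_mul, derivative_comp, derivative_C, derivative_X, zero_mul,
    zero_add, mul_one]
  simp only [C_mul, C_add, C_pow, map_natCast, C_ofNat, map_one, Nat.cast_ofNat] at h ⊢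
  linear_combination (-C c * C s ^ 2) * h

/-- The two factors `(2π|λ|)^{1/4}` multiply to the Jacobian of `v = √(2π|λ|) u`, which reduces the
integral to the unscaled one. -/
lemma integral_hermiteScaled_mul {lam : ℝ} (hlam : lam ≠ 0) (m n : ℕ) :
    ∫ u, hermiteScaled m lam u * hermiteScaled n lam u = if m = n then 1 else 0 := by
  have hpos : 0 < 2 * Real.pi * |lam| := by positivity
  have hs : 0 < √(2 * Real.pi * |lam|) := Real.sqrt_pos.mpr hpos
  have hq : (2 * Real.pi * |lam|) ^ (1 / 4 : ℝ) * (2 * Real.pi * |lam|) ^ (1 / 4 : ℝ)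
      = √(2 * Real.pi * |lam|) := by
    rw [← Real.rpow_add hpos, Real.sqrt_eq_rpow]; norm_num
  have h1 : ∀ u, hermiteScaled m lam u * hermiteScaled n lam u =
      √(2 * Real.pi * |lam|) * ((√Real.pi * 2 ^ m * (m.factorial : ℝ)) ^ (-(1 / 2) : ℝ) *
        (√Real.pi * 2 ^ n * (n.factorial : ℝ)) ^ (-(1 / 2) : ℝ)) *
      gaussPoly 1 (physHermite m * physHermite n) (√(2 * Real.pi * |lam|) * u) := by
    intro u
    rw [show ∀ A B : ℝ, √(2 * Real.pi * |lam|) * A * B = (2 * Real.pi * |lam|) ^ (1 / 4 : ℝ) *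
      (2 * Real.pi * |lam|) ^ (1 / 4 : ℝ) * A * B from fun A B => by rw [hq]]
    simp only [hermiteScaled, hermiteFun, hermiteH_eq, gaussPoly, eval_mul]
    have : Real.exp (-1 * (√(2 * Real.pi * |lam|) * u) ^ 2)
        = Real.exp (-(√(2 * Real.pi * |lam|) * u) ^ 2 / 2) *
          Real.exp (-(√(2 * Real.pi * |lam|) * u) ^ 2 / 2) := by
      rw [← Real.exp_add]; congr 1; ring
    rw [this]; ring
  simp_rw [h1]
  rw [integral_const_mul,
    Measure.integral_comp_mul_left (gaussPoly 1 (physHermite m * physHermite n)),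
    integral_gaussPoly_physHermite_mul, abs_of_pos (inv_pos.mpr hs), smul_eq_mul]
  split_ifs with h
  · subst h
    have hN : 0 < √Real.pi * 2 ^ m * (m.factorial : ℝ) := by positivity
    rw [← Real.rpow_add hN]
    norm_num
    rw [Real.rpow_neg_one]
    field_simp
  · simp

/-! ### Completeness of the Hermite functions -/

/-- An integrable function whose Fourier transform vanishes is zero almost everywhere. -/
lemma ae_eq_zero_of_fourier_eq_zero {g : ℝ → ℂ} (hg : Integrable g)
    (h : ∀ t : ℝ, ∫ u : ℝ, Complex.exp (t * u * Complex.I) * g u = 0) : ∀ᵐ u, g u = 0 := by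
  have hF : FourierTransform.fourier g = 0 := by
    funext w
    rw [Real.fourier_real_eq_integral_exp_smul]
    rw [Pi.zero_apply, ← h (-2 * Real.pi * w)]
    congr 1; funext u
    rw [smul_eq_mul]
    congr 2; push_cast; ring
  refine ae_eq_zero_of_integral_contDiff_smul_eq_zero hg.locallyIntegrable ?_
  intro φ hφ hφc
  have hφc' : HasCompactSupport (Complex.ofRealCLM ∘ φ) := hφc.comp_left rfl
  have hφ' : ContDiff ℝ (⊤ : ℕ∞) (Complex.ofRealCLM ∘ φ) := Complex.ofRealCLM.contDiff.comp hφ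
  -- A test function `φ` is the Fourier transform of a Schwartz function `ψ`. Moving the transform
  -- from `ψ` onto `g` turns `∫ φ g` into the integral of `ψ` against zero.
  set ψ : SchwartzMap ℝ ℂ := FourierTransformInv.fourierInv (hφc'.toSchwartzMap hφ') with hψ
  have h1 : FourierTransform.fourier (ψ : ℝ → ℂ) = (Complex.ofRealCLM ∘ φ) := by
    rw [← SchwartzMap.fourier_coe, hψ, FourierTransform.fourier_fourierInv_eq]
    rfl
  have h2 := VectorFourier.integral_fourierIntegral_smul_eq_flip (L := innerₗ ℝ)
    (μ := volume) (ν := volume) (e := Real.fourierChar) Real.continuous_fourierChar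
    (by simpa using continuous_inner (𝕜 := ℝ) (E := ℝ)) ψ.integrable hg
  have h3 : ∀ x, VectorFourier.fourierIntegral Real.fourierChar volume (innerₗ ℝ) (ψ : ℝ → ℂ) x
      = (φ x : ℂ) := fun x => congrFun h1 x
  have h4 : ∀ x, VectorFourier.fourierIntegral Real.fourierChar volume (innerₗ ℝ).flip g x = 0 := by
    intro x
    rw [flip_innerₗ]
    exact congrFun hF x
  simp only [h3, h4, smul_zero, integral_zero] at h2
  simpa using h2

/-- A polynomial times `e^{-α u²} G` is integrable if `e^{-β u²} G` is, for all `β > 0`. -/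
lemma integrable_gaussPoly_mul {G : ℝ → ℂ}
    (hG : ∀ β : ℝ, 0 < β → Integrable fun u => (Real.exp (-β * u ^ 2) : ℂ) * G u)
    {α : ℝ} (hα : 0 < α) (P : ℝ[X]) : Integrable fun u => (gaussPoly α P u : ℂ) * G u := by
  -- Half of the Gaussian bounds the polynomial, the other half makes `G` integrable.
  obtain ⟨K, hK⟩ := exists_abs_gaussPoly_le (half_pos hα) P
  have h := (hG (α / 2) (half_pos hα)).bdd_mul (c := K)
    (f := fun u => (gaussPoly (α / 2) P u : ℂ))
    (Complex.continuous_ofReal.comp (continuous_gaussPoly _ _)).aestronglyMeasurable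
    (ae_of_all _ fun u => by simpa using hK u)
  refine h.congr (ae_of_all _ fun u => ?_)
  have : Real.exp (-α * u ^ 2) = Real.exp (-(α / 2) * u ^ 2) * Real.exp (-(α / 2) * u ^ 2) := by
    rw [← Real.exp_add]; congr 1; ring
  simp only [gaussPoly, this]
  push_cast; ring

/-- The rescaled Hermite functions span all polynomials times a Gaussian. -/
lemma integral_gaussPoly_mul_eq_zero {G : ℝ → ℂ}
    (hG : ∀ β : ℝ, 0 < β → Integrable fun u => (Real.exp (-β * u ^ 2) : ℂ) * G u)
    {lam : ℝ} (hlam : lam ≠ 0) (h : ∀ l : ℕ, ∫ u, (hermiteScaled l lam u : ℂ) * G u = 0)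
    (n : ℕ) : ∫ u, (gaussPoly (Real.pi * |lam|) (X ^ n) u : ℂ) * G u = 0 := by
  have hα : 0 < Real.pi * |lam| := by positivity
  have hs : √(2 * Real.pi * |lam|) ≠ 0 := (Real.sqrt_pos.mpr (by positivity)).ne'
  have hadd : ∀ (c d : ℝ) (P Q : ℝ[X]),
      ∫ u, (gaussPoly (Real.pi * |lam|) (C c * P + C d * Q) u : ℂ) * G u =
        c * (∫ u, (gaussPoly (Real.pi * |lam|) P u : ℂ) * G u) +
        d * ∫ u, (gaussPoly (Real.pi * |lam|) Q u : ℂ) * G u := by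
    intro c d P Q
    rw [← integral_const_mul, ← integral_const_mul, ← integral_add
      ((integrable_gaussPoly_mul hG hα P).const_mul _)
      ((integrable_gaussPoly_mul hG hα Q).const_mul _)]
    congr 1; funext u
    rw [gaussPoly_add, gaussPoly_C_mul, gaussPoly_C_mul]
    push_cast; ring
  -- Quantifying over all `l` makes the induction on `n` close: the three-term recurrence absorbs
  -- one `X` at the cost of the neighbouring indices `l + 1` and `l - 1`.
  have key : ∀ n l : ℕ, ∫ u, (gaussPoly (Real.pi * |lam|)
      (X ^ n * (physHermite l).comp (C √(2 * Real.pi * |lam|) * X)) u : ℂ) * G u = 0 := by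
    intro n
    induction n with
    | zero =>
      intro l
      have h1 := h l
      simp only [hermiteScaled_eq, scaledHermitePoly, gaussPoly_C_mul] at h1
      have hm : ∀ (c g : ℝ) (z : ℂ), ((c * g : ℝ) : ℂ) * z = (c : ℂ) * ((g : ℂ) * z) := by
        intro c g z; push_cast; ring
      simp only [hm] at h1
      rw [integral_const_mul, integral_const_mul] at h1
      have h2 := (mul_eq_zero.mp h1).resolve_left
        (Complex.ofReal_ne_zero.mpr (Real.rpow_pos_of_pos (by positivity) _).ne')
      have h3 := (mul_eq_zero.mp h2).resolve_left
        (Complex.ofReal_ne_zero.mpr (Real.rpow_pos_of_pos (by positivity) _).ne')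
      rw [pow_zero, one_mul]
      exact h3
    | succ n ih =>
      intro l
      have hX : X ^ (n + 1) * (physHermite l).comp (C √(2 * Real.pi * |lam|) * X) =
          C (1 / (2 * √(2 * Real.pi * |lam|))) *
            (X ^ n * (physHermite (l + 1)).comp (C √(2 * Real.pi * |lam|) * X)) +
          C (l / √(2 * Real.pi * |lam|)) *
            (X ^ n * (physHermite (l - 1)).comp (C √(2 * Real.pi * |lam|) * X)) := by
        have h1 := congrArg (fun p : ℝ[X] => p.comp (C √(2 * Real.pi * |lam|) * X))
          (X_mul_physHermite l)
        simp only [add_comp, mul_comp, C_comp, X_comp] at h1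
        generalize √(2 * Real.pi * |lam|) = s at *
        have e1 : (C s⁻¹ * C s : ℝ[X]) = 1 := by rw [← C_mul, inv_mul_cancel₀ hs, C_1]
        have e2 : (C (1 / (2 * s)) : ℝ[X]) = C (1 / 2) * C s⁻¹ := by
          rw [← C_mul]; congr 1; field_simp
        have e3 : (C (l / s) : ℝ[X]) = C (l : ℝ) * C s⁻¹ := by
          rw [← C_mul]; congr 1
        rw [e2, e3]
        linear_combination C s⁻¹ * X ^ n * h1 -
          X ^ (n + 1) * (physHermite l).comp (C s * X) * e1
      rw [hX, hadd, ih, ih]; simp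
  simpa [physHermite] using key n 0

/-- Completeness of the Hermite functions. -/
lemma ae_eq_zero_of_integral_hermiteScaled_eq_zero {G : ℝ → ℂ}
    (hG : ∀ β : ℝ, 0 < β → Integrable fun u => (Real.exp (-β * u ^ 2) : ℂ) * G u)
    {lam : ℝ} (hlam : lam ≠ 0) (h : ∀ l : ℕ, ∫ u, (hermiteScaled l lam u : ℂ) * G u = 0) :
    ∀ᵐ u, G u = 0 := by
  have hα : 0 < Real.pi * |lam| := by positivity
  set α := Real.pi * |lam| with hαdef
  have hint := hG α hα
  have hz : ∀ᵐ u, (Real.exp (-α * u ^ 2) : ℂ) * G u = 0 := by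
    -- Expand `e^{itu}` in its power series: each term integrates to zero by the vanishing moments,
    -- and dominated convergence sums them.
    refine ae_eq_zero_of_fourier_eq_zero hint fun t => ?_
    have hF : ∀ n : ℕ, Integrable fun u : ℝ =>
        (t * u * Complex.I) ^ n / (n.factorial : ℂ) * ((Real.exp (-α * u ^ 2) : ℂ) * G u) := by
      intro n
      refine ((integrable_gaussPoly_mul hG hα (X ^ n)).const_mul
        ((t * Complex.I) ^ n / (n.factorial : ℂ))).congr (ae_of_all _ fun u => ?_)
      simp only [gaussPoly, eval_pow, eval_X]
      push_cast; ring
    have hF0 : ∀ n : ℕ, ∫ u : ℝ,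
        (t * u * Complex.I) ^ n / (n.factorial : ℂ) * ((Real.exp (-α * u ^ 2) : ℂ) * G u) = 0 := by
      intro n
      have h1 := integral_gaussPoly_mul_eq_zero hG hlam h n
      rw [← hαdef] at h1
      rw [← mul_zero ((t * Complex.I) ^ n / (n.factorial : ℂ)), ← h1, ← integral_const_mul]
      congr 1; funext u
      simp only [gaussPoly, eval_pow, eval_X]
      push_cast; ring
    have hdom := hasSum_integral_of_dominated_convergence (μ := volume)
      (F := fun (n : ℕ) (u : ℝ) =>
        (t * u * Complex.I) ^ n / (n.factorial : ℂ) * ((Real.exp (-α * u ^ 2) : ℂ) * G u))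
      (f := fun u => Complex.exp (t * u * Complex.I) * ((Real.exp (-α * u ^ 2) : ℂ) * G u))
      (bound := fun n u => |t * u| ^ n / (n.factorial : ℝ) * ‖(Real.exp (-α * u ^ 2) : ℂ) * G u‖)
      (fun n => (hF n).aestronglyMeasurable)
      (fun n => ae_of_all _ fun u => by simp [abs_mul])
      (ae_of_all _ fun u => (Real.summable_pow_div_factorial _).mul_right _)
      ?_ (ae_of_all _ fun u => ?_)
    · simp only [hF0] at hdom
      exact (hasSum_zero.unique hdom).symm
    · simp_rw [tsum_mul_right]
      have hexp : ∀ u : ℝ, ∑' n : ℕ, |t * u| ^ n / (n.factorial : ℝ) = Real.exp |t * u| := by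
        intro u
        rw [Real.exp_eq_exp_ℝ, NormedSpace.exp_eq_tsum_div]
      simp_rw [hexp]
      -- Completing the square gives `|tu| ≤ t²/(2α) + αu²/2`, so `e^{|tu|}` costs a constant and
      -- half of the Gaussian.
      have hhalf := (hG (α / 2) (half_pos hα)).norm.const_mul (Real.exp (t ^ 2 / (2 * α)))
      refine hhalf.mono' ?_ (ae_of_all _ fun u => ?_)
      · exact (by fun_prop : Continuous fun u : ℝ => Real.exp |t * u|).aestronglyMeasurable.mul
          hint.norm.aestronglyMeasurable
      · have e1 : |t * u| - α * u ^ 2 ≤ t ^ 2 / (2 * α) + -(α / 2) * u ^ 2 := by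
          have : |t * u| ≤ t ^ 2 / (2 * α) + α / 2 * u ^ 2 := by
            rw [abs_mul]
            have e2 : t ^ 2 / (2 * α) + α / 2 * u ^ 2 - |t| * |u|
                = (|t| - α * |u|) ^ 2 / (2 * α) := by
              field_simp
              rw [← sq_abs t, ← sq_abs u]; ring
            have : 0 ≤ (|t| - α * |u|) ^ 2 / (2 * α) := by positivity
            linarith
          linarith
        have e3 := Real.exp_le_exp.mpr e1
        rw [sub_eq_add_neg, Real.exp_add, Real.exp_add] at e3
        rw [norm_mul, norm_norm, norm_mul, norm_mul, Complex.norm_real, Complex.norm_real,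
          Real.norm_eq_abs, Real.abs_exp, Real.norm_eq_abs, Real.abs_exp, Real.norm_eq_abs,
          Real.abs_exp, ← mul_assoc, ← mul_assoc]
        rw [neg_mul]
        exact mul_le_mul_of_nonneg_right e3 (norm_nonneg _)
    · refine HasSum.mul_right _ ?_
      rw [Complex.exp_eq_exp_ℂ]
      exact NormedSpace.expSeries_div_hasSum_exp (t * u * Complex.I)
  filter_upwards [hz] with u hu
  rcases mul_eq_zero.mp hu with h0 | h0
  · exact absurd (Complex.ofReal_eq_zero.mp h0) (Real.exp_pos _).ne'
  · exact h0

/-! ### Berezin-Weil-Zak transforms of polynomials times a Gaussian -/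

lemma norm_bwzTerm (lam q : ℤ) (h : ℝ → ℂ) (x : Heis) (k : ℤ) :
    ‖bwzTerm lam q h x k‖ = ‖h ((k : ℝ) / (lam : ℝ) + x.a)‖ := by
  have h1 : ‖Complex.exp (-(2 * Real.pi * Complex.I * q * (k / lam)))‖ = 1 := by
    have : -(2 * Real.pi * Complex.I * q * (k / lam) : ℂ)
        = ((-(2 * Real.pi * q * (k / lam)) : ℝ) : ℂ) * Complex.I := by push_cast; ring
    rw [this, Complex.norm_exp_ofReal_mul_I]
  have h2 : ‖Complex.exp (2 * Real.pi * Complex.I * (lam * x.c + k * x.b))‖ = 1 := by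
    have : (2 * Real.pi * Complex.I * (lam * x.c + k * x.b) : ℂ)
        = ((2 * Real.pi * (lam * x.c + k * x.b) : ℝ) : ℂ) * Complex.I := by push_cast; ring
    rw [this, Complex.norm_exp_ofReal_mul_I]
  rw [bwzTerm, norm_mul, norm_mul, h1, h2, one_mul, one_mul]

lemma summable_inv_one_add_int_sq : Summable fun k : ℤ => (1 + (k : ℝ) ^ 2)⁻¹ := by
  refine Summable.of_norm_bounded_eventually (g := fun k : ℤ => 1 / (k : ℝ) ^ 2)
    (Real.summable_one_div_int_pow.mpr one_lt_two) ?_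
  filter_upwards [(Set.finite_singleton (0 : ℤ)).compl_mem_cofinite] with k hk
  have hk' : (k : ℝ) ≠ 0 := by exact_mod_cast hk
  have : 0 < (k : ℝ) ^ 2 := by positivity
  rw [Real.norm_of_nonneg (by positivity), one_div]
  exact inv_anti₀ this (by linarith)

/-- With `v = k/λ + a` one has `k = λ(v - a)`, so `k² ≤ 2λ²(v² + a²)` and decay in `v` becomes decay
in `k`, uniformly for bounded `a`. This is the majorant for every exchange of the series with a
limit. -/
lemma exists_abs_gaussPoly_shift_le {α : ℝ} (hα : 0 < α) (P : ℝ[X]) {lam : ℝ} (hlam : lam ≠ 0)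
    (R : ℝ) : ∃ K : ℝ, 0 ≤ K ∧ ∀ (k : ℤ) (a : ℝ), |a| ≤ R →
      |gaussPoly α P (k / lam + a)| ≤ K * (1 + (k : ℝ) ^ 2)⁻¹ := by
  obtain ⟨K, hK0, hK⟩ := exists_abs_gaussPoly_le_inv hα P
  refine ⟨K * (1 + 2 * lam ^ 2 * (1 + R ^ 2)), by positivity, fun k a ha => ?_⟩
  refine (hK _).trans ?_
  rw [mul_assoc]
  refine mul_le_mul_of_nonneg_left ?_ hK0
  rw [← div_eq_mul_inv, inv_eq_one_div, div_le_div_iff₀ (by positivity) (by positivity), one_mul]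
  have hk : (k : ℝ) = lam * ((k / lam + a) - a) := by field_simp; ring
  generalize (k : ℝ) / lam + a = v at hk
  have h1 : (k : ℝ) ^ 2 ≤ 2 * lam ^ 2 * (v ^ 2 + a ^ 2) := by
    rw [hk]; nlinarith [sq_nonneg (lam * (v + a))]
  have h2 : a ^ 2 ≤ R ^ 2 := sq_le_sq' (by linarith [(abs_le.mp ha).1]) (abs_le.mp ha).2
  have h3 : lam ^ 2 * a ^ 2 ≤ lam ^ 2 * R ^ 2 := by gcongr
  have h4 : 0 ≤ lam ^ 2 * R ^ 2 * v ^ 2 := by positivity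
  have h5 : 0 ≤ v ^ 2 := by positivity
  have h6 : 0 ≤ lam ^ 2 := by positivity
  nlinarith

/-- The `k`-th term of the transform of `P e^{-π|λ|v²}`, as a function on `ℝ³`. -/
noncomputable def gaussTerm (lam q : ℤ) (P : ℝ[X]) (k : ℤ) (p : ℝ × ℝ × ℝ) : ℂ :=
  bwzTerm lam q (fun u => (gaussPoly (Real.pi * |(lam : ℝ)|) P u : ℂ)) (Heis.coord.symm p) k

/-- The transform of `P e^{-π|λ|v²}`, as a function on `ℝ³`. -/
noncomputable def gaussSeries (lam q : ℤ) (P : ℝ[X]) (p : ℝ × ℝ × ℝ) : ℂ :=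
  ∑' k : ℤ, gaussTerm lam q P k p

lemma norm_gaussTerm (lam q : ℤ) (P : ℝ[X]) (k : ℤ) (p : ℝ × ℝ × ℝ) :
    ‖gaussTerm lam q P k p‖ =
      |gaussPoly (Real.pi * |(lam : ℝ)|) P ((k : ℝ) / (lam : ℝ) + p.1)| := by
  rw [gaussTerm, norm_bwzTerm, Complex.norm_real, Real.norm_eq_abs]; rfl

lemma exists_norm_gaussTerm_le {lam : ℤ} (hlam : lam ≠ 0) (q : ℤ) (P : ℝ[X]) (R : ℝ) :
    ∃ K : ℝ, 0 ≤ K ∧ ∀ (k : ℤ) (p : ℝ × ℝ × ℝ), |p.1| ≤ R →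
      ‖gaussTerm lam q P k p‖ ≤ K * (1 + (k : ℝ) ^ 2)⁻¹ := by
  have hl : (lam : ℝ) ≠ 0 := by exact_mod_cast hlam
  obtain ⟨K, hK0, hK⟩ := exists_abs_gaussPoly_shift_le
    (show 0 < Real.pi * |(lam : ℝ)| by positivity) P hl R
  exact ⟨K, hK0, fun k p hp => by rw [norm_gaussTerm]; exact hK k p.1 hp⟩

lemma summable_gaussTerm {lam : ℤ} (hlam : lam ≠ 0) (q : ℤ) (P : ℝ[X]) (p : ℝ × ℝ × ℝ) :
    Summable fun k => gaussTerm lam q P k p := by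
  obtain ⟨K, -, hK⟩ := exists_norm_gaussTerm_le hlam q P |p.1|
  exact Summable.of_norm_bounded (summable_inv_one_add_int_sq.mul_left K)
    fun k => hK k p le_rfl

/-- The coordinate form `da`. -/
noncomputable def formA : ℝ × ℝ × ℝ →L[ℝ] ℝ := ContinuousLinearMap.fst ℝ ℝ (ℝ × ℝ)
/-- The coordinate form `db`. -/
noncomputable def formB : ℝ × ℝ × ℝ →L[ℝ] ℝ :=
  (ContinuousLinearMap.fst ℝ ℝ ℝ).comp (ContinuousLinearMap.snd ℝ ℝ (ℝ × ℝ))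
/-- The coordinate form `dc`. -/
noncomputable def formC : ℝ × ℝ × ℝ →L[ℝ] ℝ :=
  (ContinuousLinearMap.snd ℝ ℝ ℝ).comp (ContinuousLinearMap.snd ℝ ℝ (ℝ × ℝ))

/-- The factor `2πik` from `∂_b` is written as `2πiλ((k/λ + a) - a)`. The derivative is thus a
combination of terms of the same kind whose coefficients do not depend on `k`, so it can be summed
over `k`. -/
lemma hasFDerivAt_gaussTerm {lam : ℤ} (hlam : lam ≠ 0) (q : ℤ) (P : ℝ[X]) (k : ℤ)
    (p : ℝ × ℝ × ℝ) :
    HasFDerivAt (gaussTerm lam q P k)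
      (formA.smulRight (gaussTerm lam q (gaussDeriv (Real.pi * |(lam : ℝ)|) P) k p) +
        formB.smulRight (2 * Real.pi * Complex.I * lam *
          (gaussTerm lam q (X * P) k p - p.1 * gaussTerm lam q P k p)) +
        formC.smulRight (2 * Real.pi * Complex.I * lam * gaussTerm lam q P k p)) p := by
  have hl : (lam : ℂ) ≠ 0 := by exact_mod_cast hlam
  have hA : HasFDerivAt (fun p : ℝ × ℝ × ℝ => p.1) formA p := formA.hasFDerivAt
  have hB : HasFDerivAt (fun p : ℝ × ℝ × ℝ => (p.2.1 : ℂ)) (Complex.ofRealCLM.comp formB) p :=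
    (Complex.ofRealCLM.comp formB).hasFDerivAt
  have hC : HasFDerivAt (fun p : ℝ × ℝ × ℝ => (p.2.2 : ℂ)) (Complex.ofRealCLM.comp formC) p :=
    (Complex.ofRealCLM.comp formC).hasFDerivAt
  have h1 := (Complex.ofRealCLM.hasFDerivAt).comp p ((hasDerivAt_gaussPoly (Real.pi * |(lam : ℝ)|) P
    ((k : ℝ) / (lam : ℝ) + p.1)).comp_hasFDerivAt p (hA.const_add _))
  have h2 := (((hC.const_mul (lam : ℂ)).add
    (hB.const_mul (k : ℂ))).const_mul (2 * Real.pi * Complex.I)).cexp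
  have h3 := ((h2.const_mul (Complex.exp (-(2 * Real.pi * Complex.I * q * (k / lam))))).mul h1)
  refine h3.congr_fderiv ?_
  ext <;>
  simp [formA, formB, formC, gaussTerm, bwzTerm, Heis.coord, gaussPoly_X_mul]
  all_goals field_simp
  all_goals ring

lemma norm_formA_le : ‖formA‖ ≤ 1 := ContinuousLinearMap.norm_fst_le ℝ ℝ (ℝ × ℝ)

lemma norm_formB_le : ‖formB‖ ≤ 1 :=
  (ContinuousLinearMap.opNorm_comp_le _ _).trans (mul_le_one₀
    (ContinuousLinearMap.norm_fst_le ℝ ℝ ℝ) (norm_nonneg _)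
    (ContinuousLinearMap.norm_snd_le ℝ ℝ (ℝ × ℝ)))

lemma norm_formC_le : ‖formC‖ ≤ 1 :=
  (ContinuousLinearMap.opNorm_comp_le _ _).trans (mul_le_one₀
    (ContinuousLinearMap.norm_snd_le ℝ ℝ ℝ) (norm_nonneg _)
    (ContinuousLinearMap.norm_snd_le ℝ ℝ (ℝ × ℝ)))

/-- The differential of a series of transforms, term by term. -/
lemma hasFDerivAt_gaussSeries {lam : ℤ} (hlam : lam ≠ 0) (q : ℤ) (P : ℝ[X]) (p : ℝ × ℝ × ℝ) :
    HasFDerivAt (gaussSeries lam q P)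
      (formA.smulRight (gaussSeries lam q (gaussDeriv (Real.pi * |(lam : ℝ)|) P) p) +
        formB.smulRight (2 * Real.pi * Complex.I * lam *
          (gaussSeries lam q (X * P) p - p.1 * gaussSeries lam q P p)) +
        formC.smulRight (2 * Real.pi * Complex.I * lam * gaussSeries lam q P p)) p := by
  -- The majorants are uniform on the slab `|a| < R`; `b` and `c` need no bound, as they enter only
  -- through factors of modulus one.
  set R : ℝ := |p.1| + 1 with hR
  have hR0 : 0 ≤ R := by positivity
  obtain ⟨K1, hK1, h1⟩ := exists_norm_gaussTerm_le hlam q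
    (gaussDeriv (Real.pi * |(lam : ℝ)|) P) R
  obtain ⟨K2, hK2, h2⟩ := exists_norm_gaussTerm_le hlam q (X * P) R
  obtain ⟨K3, hK3, h3⟩ := exists_norm_gaussTerm_le hlam q P R
  have hs1 := (summable_gaussTerm hlam q (gaussDeriv (Real.pi * |(lam : ℝ)|) P) p).hasSum
  have hs2 := (summable_gaussTerm hlam q (X * P) p).hasSum
  have hs3 := (summable_gaussTerm hlam q P p).hasSum
  set w : ℂ := 2 * Real.pi * Complex.I * lam with hw
  have hsum := (((ContinuousLinearMap.smulRightL ℝ (ℝ × ℝ × ℝ) ℂ formA).hasSum hs1).add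
    ((ContinuousLinearMap.smulRightL ℝ (ℝ × ℝ × ℝ) ℂ formB).hasSum
      ((hs2.sub (hs3.mul_left (p.1 : ℂ))).mul_left w))).add
    ((ContinuousLinearMap.smulRightL ℝ (ℝ × ℝ × ℝ) ℂ formC).hasSum (hs3.mul_left w))
  have hopen : IsOpen {y : ℝ × ℝ × ℝ | |y.1| < R} :=
    isOpen_lt (continuous_abs.comp continuous_fst) continuous_const
  have hconn : IsPreconnected {y : ℝ × ℝ × ℝ | |y.1| < R} := by
    have : {y : ℝ × ℝ × ℝ | |y.1| < R} = Set.Ioo (-R) R ×ˢ Set.univ := by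
      ext y; simp [abs_lt]
    rw [this]
    exact isPreconnected_Ioo.prod isPreconnected_univ
  have hp : p ∈ {y : ℝ × ℝ × ℝ | |y.1| < R} := by simp [hR]
  have hmain := hasFDerivAt_tsum_of_isPreconnected (𝕜 := ℝ)
    (u := fun k : ℤ => (K1 + ‖w‖ * (K2 + R * K3) + ‖w‖ * K3) * (1 + (k : ℝ) ^ 2)⁻¹)
    (summable_inv_one_add_int_sq.mul_left _) hopen hconn
    (fun k y _ => hasFDerivAt_gaussTerm hlam q P k y) ?_ hp hs3.summable hp
  · rw [← hw] at hmain
    have := hsum.tsum_eq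
    simp only [ContinuousLinearMap.smulRightL_apply_apply] at this
    rw [this] at hmain
    exact hmain
  · intro k y hy
    have hy' : |y.1| ≤ R := le_of_lt hy
    rw [← hw]
    have e1 := h1 k y hy'
    have e2 := h2 k y hy'
    have e3 := h3 k y hy'
    have e4 : ‖gaussTerm lam q (X * P) k y - y.1 * gaussTerm lam q P k y‖ ≤
        (K2 + R * K3) * (1 + (k : ℝ) ^ 2)⁻¹ := by
      refine (norm_sub_le _ _).trans ?_
      rw [norm_mul, Complex.norm_real, Real.norm_eq_abs, add_mul, mul_assoc]
      exact add_le_add e2 (mul_le_mul hy' e3 (norm_nonneg _) hR0)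
    refine (norm_add₃_le ..).trans ?_
    simp only [ContinuousLinearMap.norm_smulRight_apply]
    rw [add_mul, add_mul, mul_assoc ‖w‖, mul_assoc ‖w‖]
    refine add_le_add (add_le_add ?_ ?_) ?_
    · exact (mul_le_of_le_one_left (norm_nonneg _) norm_formA_le).trans e1
    · refine (mul_le_of_le_one_left (norm_nonneg _) norm_formB_le).trans ?_
      rw [norm_mul]
      exact mul_le_mul_of_nonneg_left e4 (norm_nonneg _)
    · refine (mul_le_of_le_one_left (norm_nonneg _) norm_formC_le).trans ?_
      rw [norm_mul]
      exact mul_le_mul_of_nonneg_left e3 (norm_nonneg _)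

/-- The differential involves only the series of `P`, `X * P` and `gaussDeriv P`, so an induction on
the order of smoothness works when it runs over all `P` at once. -/
lemma contDiff_gaussSeries {lam : ℤ} (hlam : lam ≠ 0) (q : ℤ) (P : ℝ[X]) :
    ContDiff ℝ ((⊤ : ℕ∞) : WithTop ℕ∞) (gaussSeries lam q P) := by
  rw [contDiff_infty]
  intro n
  induction n generalizing P with
  | zero =>
    exact contDiff_zero.mpr (continuous_iff_continuousAt.mpr
      fun p => (hasFDerivAt_gaussSeries hlam q P p).continuousAt)
  | succ n ih =>
    push_cast
    refine contDiff_succ_iff_fderiv.mpr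
      ⟨fun p => (hasFDerivAt_gaussSeries hlam q P p).differentiableAt, by simp, ?_⟩
    rw [funext fun p => (hasFDerivAt_gaussSeries hlam q P p).fderiv]
    have h1 := ih P
    have h2 := ih (X * P)
    have h3 := ih (gaussDeriv (Real.pi * |(lam : ℝ)|) P)
    have h4 : ContDiff ℝ n fun p : ℝ × ℝ × ℝ => (p.1 : ℂ) :=
      Complex.ofRealCLM.contDiff.comp contDiff_fst
    refine ((contDiff_const.smulRight h3).add (contDiff_const.smulRight
      (contDiff_const.mul (h2.sub (h4.mul h1))))).add
      (contDiff_const.smulRight (contDiff_const.mul h1))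

/-! ### The left-invariant fields -/

lemma fieldA_eq {F : Nil → ℂ} {L : ℝ × ℝ × ℝ →L[ℝ] ℂ} {x : Heis}
    (h : HasFDerivAt (fun p : ℝ × ℝ × ℝ => F (proj (Heis.coord.symm p))) L (Heis.coord x)) :
    fieldA F (proj x) = L (1, 0, 0) := by
  have hc : HasDerivAt (fun t : ℝ => ((x.a + t, x.b, x.c) : ℝ × ℝ × ℝ)) (1, 0, 0) 0 :=
    ((hasDerivAt_id (0 : ℝ)).const_add x.a).prodMk
      ((hasDerivAt_const (0 : ℝ) x.b).prodMk (hasDerivAt_const (0 : ℝ) x.c))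
  have h' : HasFDerivAt (fun p : ℝ × ℝ × ℝ => F (proj (Heis.coord.symm p))) L
      ((fun t : ℝ => ((x.a + t, x.b, x.c) : ℝ × ℝ × ℝ)) 0) := by
    simpa [Heis.coord] using h
  refine (HasDerivAt.congr_of_eventuallyEq (h'.comp_hasDerivAt (0 : ℝ) hc)
    (Filter.Eventually.of_forall fun t => ?_)).deriv
  change F (proj (x * ⟨t, 0, 0⟩)) = F (proj ⟨x.a + t, x.b, x.c⟩)
  congr 2
  ext <;> simp

/-- Right translation by `(0, t, 0)` moves `(a, b, c)` along `(a, b + t, c + at)`, with velocity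
`(0, 1, a)`. -/
lemma fieldB_eq {F : Nil → ℂ} {L : ℝ × ℝ × ℝ →L[ℝ] ℂ} {x : Heis}
    (h : HasFDerivAt (fun p : ℝ × ℝ × ℝ => F (proj (Heis.coord.symm p))) L (Heis.coord x)) :
    fieldB F (proj x) = L (0, 1, x.a) := by
  have hc : HasDerivAt (fun t : ℝ => ((x.a, x.b + t, x.c + x.a * t) : ℝ × ℝ × ℝ))
      (0, 1, x.a) 0 :=
    (hasDerivAt_const (0 : ℝ) x.a).prodMk
      (((hasDerivAt_id (0 : ℝ)).const_add x.b).prodMk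
        (by simpa using ((hasDerivAt_id (0 : ℝ)).const_mul x.a).const_add x.c))
  have h' : HasFDerivAt (fun p : ℝ × ℝ × ℝ => F (proj (Heis.coord.symm p))) L
      ((fun t : ℝ => ((x.a, x.b + t, x.c + x.a * t) : ℝ × ℝ × ℝ)) 0) := by
    simpa [Heis.coord] using h
  refine (HasDerivAt.congr_of_eventuallyEq (h'.comp_hasDerivAt (0 : ℝ) hc)
    (Filter.Eventually.of_forall fun t => ?_)).deriv
  change F (proj (x * ⟨0, t, 0⟩)) = F (proj ⟨x.a, x.b + t, x.c + x.a * t⟩)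
  congr 2
  ext <;> simp

lemma fieldA_const_mul (c : ℂ) (F : Nil → ℂ) :
    fieldA (fun p => c * F p) = fun p => c * fieldA F p := by
  funext p; exact deriv_const_mul_field c

lemma fieldB_const_mul (c : ℂ) (F : Nil → ℂ) :
    fieldB (fun p => c * F p) = fun p => c * fieldB F p := by
  funext p; exact deriv_const_mul_field c

lemma exists_proj_eq (p : Nil) : ∃ x : Heis, proj x = p := Quotient.exists_rep p

/-! ### The characters -/

lemma hasFDerivAt_chi (ω : ℤ × ℤ) (p : ℝ × ℝ × ℝ) :
    HasFDerivAt (fun p : ℝ × ℝ × ℝ => chi ω (proj (Heis.coord.symm p)))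
      (formA.smulRight (2 * Real.pi * Complex.I * ω.1 * chi ω (proj (Heis.coord.symm p))) +
        formB.smulRight (2 * Real.pi * Complex.I * ω.2 * chi ω (proj (Heis.coord.symm p)))) p := by
  have hA : HasFDerivAt (fun p : ℝ × ℝ × ℝ => (p.1 : ℂ)) (Complex.ofRealCLM.comp formA) p :=
    (Complex.ofRealCLM.comp formA).hasFDerivAt
  have hB : HasFDerivAt (fun p : ℝ × ℝ × ℝ => (p.2.1 : ℂ)) (Complex.ofRealCLM.comp formB) p :=
    (Complex.ofRealCLM.comp formB).hasFDerivAt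
  have h2 := (((hA.const_mul (ω.1 : ℂ)).add
    (hB.const_mul (ω.2 : ℂ))).const_mul (2 * Real.pi * Complex.I)).cexp
  refine h2.congr_fderiv ?_
  ext <;> simp [formA, formB, chi, descend, proj, Heis.coord] <;> ring

lemma isSmooth_chi (ω : ℤ × ℤ) : IsSmooth (chi ω) := by
  change ContDiff ℝ _ fun p : ℝ × ℝ × ℝ =>
    Complex.exp (2 * Real.pi * Complex.I * (ω.1 * (p.1 : ℂ) + ω.2 * (p.2.1 : ℂ)))
  have hA : ContDiff ℝ ((⊤ : ℕ∞) : WithTop ℕ∞) (fun p : ℝ × ℝ × ℝ => (p.1 : ℂ)) :=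
    (Complex.ofRealCLM.comp formA).contDiff
  have hB : ContDiff ℝ ((⊤ : ℕ∞) : WithTop ℕ∞) (fun p : ℝ × ℝ × ℝ => (p.2.1 : ℂ)) :=
    (Complex.ofRealCLM.comp formB).contDiff
  exact (contDiff_const.mul ((contDiff_const.mul hA).add (contDiff_const.mul hB))).cexp

lemma fieldA_chi (ω : ℤ × ℤ) :
    fieldA (chi ω) = fun p => 2 * Real.pi * Complex.I * ω.1 * chi ω p := by
  funext p
  obtain ⟨x, rfl⟩ := exists_proj_eq p
  rw [fieldA_eq (hasFDerivAt_chi ω (Heis.coord x))]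
  simp [formA, formB]

lemma fieldB_chi (ω : ℤ × ℤ) :
    fieldB (chi ω) = fun p => 2 * Real.pi * Complex.I * ω.2 * chi ω p := by
  funext p
  obtain ⟨x, rfl⟩ := exists_proj_eq p
  rw [fieldB_eq (hasFDerivAt_chi ω (Heis.coord x))]
  simp [formA, formB]

lemma subLaplacian_chi (ω : ℤ × ℤ) : subLaplacian (chi ω) =
    fun p => (((2 * Real.pi) ^ 2 * ((ω.1 : ℝ) ^ 2 + (ω.2 : ℝ) ^ 2) : ℝ) : ℂ) * chi ω p := by
  funext p
  rw [subLaplacian, fieldA_chi, fieldB_chi, fieldA_const_mul, fieldB_const_mul, fieldA_chi,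
    fieldB_chi]
  push_cast
  linear_combination (-(2 * Real.pi) ^ 2 * ((ω.1 : ℂ) ^ 2 + (ω.2 : ℂ) ^ 2) * chi ω p) *
    Complex.I_sq

/-! ### The functions `h_{λ,q,ℓ}` are smooth eigenfunctions -/

/-- The transform of `P e^{-π|λ|v²}`. -/
noncomputable def gaussBwz (lam q : ℤ) (P : ℝ[X]) : Nil → ℂ :=
  bwz lam q fun u => (gaussPoly (Real.pi * |(lam : ℝ)|) P u : ℂ)

lemma gaussBwz_proj (lam q : ℤ) (P : ℝ[X]) (p : ℝ × ℝ × ℝ) :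
    gaussBwz lam q P (proj (Heis.coord.symm p)) =
      ((√|(lam : ℝ)| / (lam : ℝ) : ℝ) : ℂ) * gaussSeries lam q P p := rfl

lemma isSmooth_gaussBwz {lam : ℤ} (hlam : lam ≠ 0) (q : ℤ) (P : ℝ[X]) :
    IsSmooth (gaussBwz lam q P) :=
  contDiff_const.mul (contDiff_gaussSeries hlam q P)

lemma fieldA_gaussBwz {lam : ℤ} (hlam : lam ≠ 0) (q : ℤ) (P : ℝ[X]) :
    fieldA (gaussBwz lam q P) = gaussBwz lam q (gaussDeriv (Real.pi * |(lam : ℝ)|) P) := by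
  funext p
  obtain ⟨x, rfl⟩ := exists_proj_eq p
  have h := (hasFDerivAt_gaussSeries hlam q P (Heis.coord x)).const_mul
    ((√|(lam : ℝ)| / (lam : ℝ) : ℝ) : ℂ)
  rw [fieldA_eq (F := gaussBwz lam q P) h]
  rw [← Heis.coord.symm_apply_apply x, gaussBwz_proj]
  simp [formA, formB, formC]

/-- The summand `-a` in the `b`-derivative cancels against `a∂_c`. -/
lemma fieldB_gaussBwz {lam : ℤ} (hlam : lam ≠ 0) (q : ℤ) (P : ℝ[X]) :
    fieldB (gaussBwz lam q P) =
      fun p => 2 * Real.pi * Complex.I * lam * gaussBwz lam q (X * P) p := by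
  funext p
  obtain ⟨x, rfl⟩ := exists_proj_eq p
  have h := (hasFDerivAt_gaussSeries hlam q P (Heis.coord x)).const_mul
    ((√|(lam : ℝ)| / (lam : ℝ) : ℝ) : ℂ)
  rw [fieldB_eq (F := gaussBwz lam q P) h]
  conv_rhs => rw [← Heis.coord.symm_apply_apply x, gaussBwz_proj]
  simp [formA, formB, formC]
  have : (Heis.coord x).1 = x.a := rfl
  rw [this]
  ring

lemma gaussBwz_C_mul (lam q : ℤ) (c : ℝ) (P : ℝ[X]) :
    gaussBwz lam q (C c * P) = fun p => (c : ℂ) * gaussBwz lam q P p := by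
  funext p
  obtain ⟨x, rfl⟩ := exists_proj_eq p
  rw [← Heis.coord.symm_apply_apply x, gaussBwz_proj, gaussBwz_proj, gaussSeries, gaussSeries,
    mul_left_comm, ← tsum_mul_left (a := (c : ℂ))]
  congr 2; funext k
  simp only [gaussTerm, bwzTerm, gaussPoly_C_mul]
  push_cast; ring

lemma gaussBwz_sub {lam : ℤ} (hlam : lam ≠ 0) (q : ℤ) (P Q : ℝ[X]) :
    gaussBwz lam q (P - Q) = fun p => gaussBwz lam q P p - gaussBwz lam q Q p := by
  funext p
  obtain ⟨x, rfl⟩ := exists_proj_eq p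
  rw [← Heis.coord.symm_apply_apply x, gaussBwz_proj, gaussBwz_proj, gaussBwz_proj, gaussSeries,
    gaussSeries, gaussSeries, ← mul_sub,
    ← (summable_gaussTerm hlam q P _).tsum_sub (summable_gaussTerm hlam q Q _)]
  congr 2; funext k
  simp only [gaussTerm, bwzTerm, gaussPoly_sub]
  push_cast; ring

lemma subLaplacian_gaussBwz {lam : ℤ} (hlam : lam ≠ 0) (q : ℤ) (P : ℝ[X]) :
    subLaplacian (gaussBwz lam q P) = gaussBwz lam q
      (C ((2 * (Real.pi * |(lam : ℝ)|)) ^ 2) * (X * (X * P)) -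
        gaussDeriv (Real.pi * |(lam : ℝ)|) (gaussDeriv (Real.pi * |(lam : ℝ)|) P)) := by
  funext p
  rw [subLaplacian, fieldA_gaussBwz hlam, fieldA_gaussBwz hlam, fieldB_gaussBwz hlam,
    fieldB_const_mul, fieldB_gaussBwz hlam, gaussBwz_sub hlam, gaussBwz_C_mul]
  have h : ((|(lam : ℝ)| : ℝ) : ℂ) ^ 2 = (lam : ℂ) ^ 2 := by
    rw [← Complex.ofReal_pow, sq_abs]; push_cast; ring
  push_cast
  linear_combination (-(2 * Real.pi) ^ 2 * (gaussBwz lam q (X * (X * P)) p)) * h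
    - (2 * Real.pi) ^ 2 * (lam : ℂ) ^ 2 * (gaussBwz lam q (X * (X * P)) p) * Complex.I_sq

lemma hFun_mk (lam q : ℤ) (l : ℕ) :
    hFun lam (QuotientAddGroup.mk q) l = gaussBwz lam q (scaledHermitePoly l lam) := by
  simp only [gaussBwz, ← hermiteScaled_eq]
  rfl

lemma isSmooth_hFun {lam : ℤ} (hlam : lam ≠ 0) (q : ZModInt lam) (l : ℕ) :
    IsSmooth (hFun lam q l) := by
  obtain ⟨q, rfl⟩ := QuotientAddGroup.mk_surjective q
  rw [hFun_mk]
  exact isSmooth_gaussBwz hlam q _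

lemma subLaplacian_hFun {lam : ℤ} (hlam : lam ≠ 0) (q : ZModInt lam) (l : ℕ) :
    subLaplacian (hFun lam q l) = fun p =>
      ((2 * Real.pi * |(lam : ℝ)| * (2 * (l : ℝ) + 1) : ℝ) : ℂ) * hFun lam q l p := by
  obtain ⟨q, rfl⟩ := QuotientAddGroup.mk_surjective q
  rw [hFun_mk, subLaplacian_gaussBwz hlam, scaledHermitePoly_ode, gaussBwz_C_mul]

lemma summable_bwzTerm_hermiteScaled {lam : ℤ} (hlam : lam ≠ 0) (q : ℤ) (l : ℕ) (x : Heis) :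
    Summable (bwzTerm lam q (fun u => (hermiteScaled l lam u : ℂ)) x) := by
  simp only [hermiteScaled_eq]
  exact summable_gaussTerm hlam q (scaledHermitePoly l lam) (Heis.coord x)

/-! ### The measure of `M` in coordinates -/

/-- The Lebesgue measure of `[0,1)`. -/
noncomputable def unitMeasure : Measure ℝ := volume.restrict (Set.Ico 0 1)

instance : IsProbabilityMeasure unitMeasure := ⟨by simp [unitMeasure]⟩

/-- The Lebesgue measure of `[0,1)³`. -/
noncomputable def cubeMeasure : Measure (ℝ × ℝ × ℝ) :=
  unitMeasure.prod (unitMeasure.prod unitMeasure)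

instance : IsProbabilityMeasure cubeMeasure := by unfold cubeMeasure; infer_instance

/-- The projection of `ℝ³` onto `M`. -/
def coordProj (p : ℝ × ℝ × ℝ) : Nil := proj (Heis.coord.symm p)

lemma measurable_coord_symm : Measurable (Heis.coord.symm : ℝ × ℝ × ℝ → Heis) :=
  measurable_comap_iff.mpr (by simpa using! measurable_id)

lemma measurable_coord : Measurable (Heis.coord : Heis → ℝ × ℝ × ℝ) :=
  comap_measurable _

lemma measurable_proj : Measurable proj := fun _ hs => hs

lemma measurable_coordProj : Measurable coordProj := measurable_proj.comp measurable_coord_symm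

/-- All integrals over `M` are computed on the cube through this map. -/
lemma measurePreserving_coordProj : MeasurePreserving coordProj cubeMeasure nilMeasure := by
  refine ⟨measurable_coordProj, ?_⟩
  have hD : fundDomain = Heis.coord ⁻¹'
      (Set.Ico (0 : ℝ) 1 ×ˢ (Set.Ico (0 : ℝ) 1 ×ˢ Set.Ico (0 : ℝ) 1)) := rfl
  have hI : MeasurableSet
      (Set.Ico (0 : ℝ) 1 ×ˢ (Set.Ico (0 : ℝ) 1 ×ˢ Set.Ico (0 : ℝ) 1)) :=
    measurableSet_Ico.prod (measurableSet_Ico.prod measurableSet_Ico)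
  have hcube : cubeMeasure = volume.restrict
      (Set.Ico (0 : ℝ) 1 ×ˢ (Set.Ico (0 : ℝ) 1 ×ˢ Set.Ico (0 : ℝ) 1)) := by
    simp only [cubeMeasure, unitMeasure, Measure.prod_restrict]; rfl
  rw [nilMeasure, Heis.haar, hD, Measure.restrict_map measurable_coord_symm (measurable_coord hI),
    Measure.map_map measurable_proj measurable_coord_symm, hcube]
  rfl

instance : IsProbabilityMeasure nilMeasure := by
  rw [← measurePreserving_coordProj.map_eq]
  exact Measure.isProbabilityMeasure_map measurable_coordProj.aemeasurable

lemma ae_mem_cube : ∀ᵐ p ∂cubeMeasure,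
    p.1 ∈ Set.Ico (0 : ℝ) 1 ∧ p.2.1 ∈ Set.Ico (0 : ℝ) 1 ∧ p.2.2 ∈ Set.Ico (0 : ℝ) 1 := by
  have h : ∀ᵐ a ∂unitMeasure, a ∈ Set.Ico (0 : ℝ) 1 := ae_restrict_mem measurableSet_Ico
  have h1 : ∀ᵐ p ∂cubeMeasure, p.1 ∈ Set.Ico (0 : ℝ) 1 :=
    Measure.quasiMeasurePreserving_fst.ae h
  have h2 : ∀ᵐ p ∂(unitMeasure.prod unitMeasure), p.1 ∈ Set.Ico (0 : ℝ) 1 :=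
    Measure.quasiMeasurePreserving_fst.ae h
  have h3 : ∀ᵐ p ∂(unitMeasure.prod unitMeasure), p.2 ∈ Set.Ico (0 : ℝ) 1 :=
    Measure.quasiMeasurePreserving_snd.ae h
  have h4 : ∀ᵐ p ∂cubeMeasure, p.2.1 ∈ Set.Ico (0 : ℝ) 1 :=
    Measure.quasiMeasurePreserving_snd.ae h2
  have h5 : ∀ᵐ p ∂cubeMeasure, p.2.2 ∈ Set.Ico (0 : ℝ) 1 :=
    Measure.quasiMeasurePreserving_snd.ae h3
  filter_upwards [h1, h4, h5] with p a b c using ⟨a, b, c⟩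

/-- Smooth functions on the compact manifold `M` are square integrable. -/
lemma memLp_of_isSmooth {F : Nil → ℂ} (hF : IsSmooth F) : MemLp F 2 nilMeasure := by
  have hc : Continuous fun p => F (coordProj p) := hF.continuous
  have hm : Measurable F := by
    have : Measurable fun x => F (proj x) := hc.measurable.comp measurable_coord
    exact measurable_from_quotient.mpr this
  obtain ⟨K, hK⟩ := ((isCompact_Icc (a := (0 : ℝ)) (b := 1)).prod
    ((isCompact_Icc (a := (0 : ℝ)) (b := 1)).prod (isCompact_Icc (a := (0 : ℝ)) (b := 1)))
    ).exists_bound_of_continuousOn hc.continuousOn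
  refine MemLp.of_bound hm.aestronglyMeasurable K ?_
  rw [← measurePreserving_coordProj.map_eq]
  refine (ae_map_iff measurable_coordProj.aemeasurable
    (measurableSet_le hm.norm measurable_const)).mpr ?_
  filter_upwards [ae_mem_cube] with p hp
  exact hK p ⟨Set.Ico_subset_Icc_self hp.1, Set.Ico_subset_Icc_self hp.2.1,
    Set.Ico_subset_Icc_self hp.2.2⟩

/-- The inner product of `L²(M)` in coordinates. -/
lemma inner_eq_integral_cube {f g : L2M} {F G : Nil → ℂ} (hF : f =ᵐ[nilMeasure] F)
    (hG : g =ᵐ[nilMeasure] G) :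
    inner ℂ f g = ∫ p, conj (F (coordProj p)) * G (coordProj p) ∂cubeMeasure := by
  have h1 : inner ℂ f g = ∫ x, conj (F x) * G x ∂nilMeasure := by
    rw [L2.inner_def]
    refine integral_congr_ae ?_
    filter_upwards [hF, hG] with x h1 h2
    rw [h1, h2, RCLike.inner_apply, mul_comm]
  have hm : AEStronglyMeasurable (fun x => conj (F x) * G x) nilMeasure :=
    ((Complex.continuous_conj.comp_aestronglyMeasurable (Lp.aestronglyMeasurable f)).mul
      (Lp.aestronglyMeasurable g)).congr (by
        filter_upwards [hF, hG] with x h1 h2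
        simp [h1, h2])
  rw [h1, ← measurePreserving_coordProj.map_eq] at *
  exact integral_map measurable_coordProj.aemeasurable hm

lemma eLpNorm_eq_one_of_inner {F : Nil → ℂ} (hF : MemLp F 2 nilMeasure)
    (h : inner ℂ (hF.toLp F) (hF.toLp F) = 1) : eLpNorm F 2 nilMeasure = 1 := by
  have h1 : ‖hF.toLp F‖ = 1 := by
    have h2 : ‖hF.toLp F‖ ^ 2 = 1 := by rw [norm_sq_eq_re_inner (𝕜 := ℂ), h]; simp
    exact (pow_eq_one_iff_of_nonneg (norm_nonneg _) two_ne_zero).mp h2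
  rw [Lp.norm_toLp] at h1
  exact (ENNReal.toReal_eq_one_iff _).mp h1

/-! ### The subspaces `L²_λ(M)` -/

lemma integral_unit_exp (n : ℤ) :
    ∫ c, Complex.exp (2 * Real.pi * Complex.I * n * (c : ℝ)) ∂unitMeasure =
      if n = 0 then 1 else 0 := by
  split_ifs with h
  · subst h; simp
  · have hn : (2 * Real.pi * Complex.I * n : ℂ) ≠ 0 := by
      simp [Real.pi_ne_zero, h]
    rw [unitMeasure, restrict_Ico_eq_restrict_Ioc, ← intervalIntegral.integral_of_le zero_le_one,
      integral_exp_mul_complex hn]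
    have : Complex.exp (2 * Real.pi * Complex.I * n * (1 : ℝ)) = 1 :=
      Complex.exp_eq_one_iff.mpr ⟨n, by push_cast; ring⟩
    rw [this]; simp

lemma integral_cube_mul (F : ℝ × ℝ → ℂ) (G : ℝ → ℂ) :
    ∫ p, F (p.1, p.2.1) * G p.2.2 ∂cubeMeasure =
      (∫ z, F z ∂(unitMeasure.prod unitMeasure)) * ∫ c, G c ∂unitMeasure := by
  rw [← integral_prod_mul, cubeMeasure,
    ← (measurePreserving_prodAssoc unitMeasure unitMeasure unitMeasure).integral_comp
      MeasurableEquiv.prodAssoc.measurableEmbedding]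
  rfl

/-- The integrand depends on `c` only through `e^{2πi(μ-λ)c}`, whose integral over a period is zero.
-/
lemma inner_L2sub_eq_zero {lam mu : ℤ} (h : lam ≠ mu) {f g : L2M} (hf : f ∈ L2sub lam)
    (hg : g ∈ L2sub mu) : inner ℂ f g = 0 := by
  obtain ⟨F, hF, hF'⟩ := hf
  obtain ⟨G, hG, hG'⟩ := hg
  rw [inner_eq_integral_cube hF hG]
  have h1 : ∀ p : ℝ × ℝ × ℝ, conj (F (coordProj p)) * G (coordProj p) =
      (conj (F (proj ⟨p.1, p.2.1, 0⟩)) * G (proj ⟨p.1, p.2.1, 0⟩)) *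
        Complex.exp (2 * Real.pi * Complex.I * (mu - lam : ℤ) * p.2.2) := by
    rintro ⟨a, b, c⟩
    change conj (F (proj ⟨a, b, c⟩)) * G (proj ⟨a, b, c⟩) = _
    rw [hF' a b c, hG' a b c, map_mul, ← Complex.exp_conj]
    have : Complex.exp (2 * Real.pi * Complex.I * (mu - lam : ℤ) * c) =
        Complex.exp (conj (2 * Real.pi * Complex.I * lam * c)) *
          Complex.exp (2 * Real.pi * Complex.I * mu * c) := by
      rw [← Complex.exp_add]
      congr 1
      simp [Complex.conj_ofNat]
      ring
    rw [this]; ring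
  simp_rw [h1]
  rw [integral_cube_mul (fun z => conj (F (proj ⟨z.1, z.2, 0⟩)) * G (proj ⟨z.1, z.2, 0⟩))
    (fun c => Complex.exp (2 * Real.pi * Complex.I * (mu - lam : ℤ) * c)), integral_unit_exp,
    if_neg (sub_ne_zero.mpr h.symm), mul_zero]

/-- The defining identity must hold everywhere for some representative of the limit. A subsequence
of the representatives converges almost everywhere; `L` is its pointwise limit, and `0` where there
is none. Since the exponential never vanishes, convergence at `(a, b, 0)` and at `(a, b, c)` are
equivalent, so `L` inherits the identity at every point. -/
lemma isClosed_L2sub (lam : ℤ) : IsClosed (L2sub lam : Set L2M) := by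
  classical
  refine isClosed_of_closure_subset fun f hf => ?_
  obtain ⟨u, hu, hlim⟩ := mem_closure_iff_seq_limit.mp hf
  choose F hF hF' using hu
  obtain ⟨ns, -, hns⟩ := (tendstoInMeasure_of_tendsto_Lp hlim).exists_seq_tendsto_ae
  have hev : ∀ p, ∀ z : ℂ, ∀ a b c : ℝ, p = proj ⟨a, b, 0⟩ →
      Filter.Tendsto (fun i => F (ns i) p) Filter.atTop (nhds z) →
      Filter.Tendsto (fun i => F (ns i) (proj ⟨a, b, c⟩)) Filter.atTop
        (nhds (z * Complex.exp (2 * Real.pi * Complex.I * lam * c))) := by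
    rintro p z a b c rfl hz
    simp_rw [fun i => hF' (ns i) a b c]
    exact hz.mul_const _
  let L : Nil → ℂ := fun p =>
    if h : ∃ z, Filter.Tendsto (fun i => F (ns i) p) Filter.atTop (nhds z) then h.choose else 0
  have hL : ∀ p z, Filter.Tendsto (fun i => F (ns i) p) Filter.atTop (nhds z) → L p = z := by
    intro p z hz
    have h : ∃ z, Filter.Tendsto (fun i => F (ns i) p) Filter.atTop (nhds z) := ⟨z, hz⟩
    have : L p = h.choose := dif_pos h
    rw [this]
    exact tendsto_nhds_unique h.choose_spec hz
  refine ⟨L, ?_, fun a b c => ?_⟩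
  · have hall : ∀ᵐ p ∂nilMeasure, ∀ i, u (ns i) p = F (ns i) p := ae_all_iff.mpr fun i => hF _
    filter_upwards [hns, hall] with p hp hp'
    exact (hL p _ (by simpa only [hp'] using hp)).symm
  · by_cases h : ∃ z, Filter.Tendsto (fun i => F (ns i) (proj ⟨a, b, 0⟩)) Filter.atTop (nhds z)
    · obtain ⟨z, hz⟩ := h
      rw [hL _ _ hz, hL _ _ (hev _ z a b c rfl hz)]
    · have h' : ¬ ∃ z, Filter.Tendsto (fun i => F (ns i) (proj ⟨a, b, c⟩)) Filter.atTop
          (nhds z) := by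
        rintro ⟨z, hz⟩
        refine h ⟨z * Complex.exp (-(2 * Real.pi * Complex.I * lam * c)), ?_⟩
        refine (hz.mul_const _).congr fun i => ?_
        rw [hF' (ns i) a b c, mul_assoc, ← Complex.exp_add, add_neg_cancel, Complex.exp_zero,
          mul_one]
      have e1 : L (proj ⟨a, b, 0⟩) = 0 := dif_neg h
      have e2 : L (proj ⟨a, b, c⟩) = 0 := dif_neg h'
      rw [e1, e2, zero_mul]

instance (lam : ℤ) : CompleteSpace (L2sub lam) := (isClosed_L2sub lam).completeSpace_coe

lemma chi_mem_L2sub {ω : ℤ × ℤ} {f : L2M} (h : f =ᵐ[nilMeasure] chi ω) : f ∈ L2sub 0 :=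
  ⟨chi ω, h, fun a b c => by simp [chi, descend, proj]⟩

lemma hFun_mem_L2sub {lam : ℤ} {q : ZModInt lam} {l : ℕ} {f : L2M}
    (h : f =ᵐ[nilMeasure] hFun lam q l) : f ∈ L2sub lam := by
  refine ⟨hFun lam q l, h, fun a b c => ?_⟩
  obtain ⟨q, rfl⟩ := QuotientAddGroup.mk_surjective q
  rw [hFun_mk]
  have e1 := gaussBwz_proj lam q (scaledHermitePoly l lam) (a, b, c)
  have e2 := gaussBwz_proj lam q (scaledHermitePoly l lam) (a, b, 0)
  change gaussBwz lam q _ (proj ⟨a, b, c⟩) = _ at e1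
  change gaussBwz lam q _ (proj ⟨a, b, 0⟩) = _ at e2
  rw [e1, e2, mul_assoc, gaussSeries, gaussSeries, ← tsum_mul_right]
  congr 2; funext k
  simp only [gaussTerm, bwzTerm, Heis.coord, Equiv.coe_fn_symm_mk]
  have : Complex.exp (2 * Real.pi * Complex.I * (lam * c + k * b)) =
      Complex.exp (2 * Real.pi * Complex.I * (lam * (0 : ℝ) + k * b)) *
        Complex.exp (2 * Real.pi * Complex.I * lam * c) := by
    rw [← Complex.exp_add]; congr 1; push_cast; ring
  rw [this]; ring

/-! ### Completeness of the trigonometric system on the cube -/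

section Torus

/-- The circle is normalised to have total length `1`, as for `UnitAddTorus.mFourierBasis`. -/
noncomputable local instance : MeasureSpace UnitAddCircle := ⟨AddCircle.haarAddCircle⟩

local instance : IsProbabilityMeasure (volume : Measure UnitAddCircle) :=
  inferInstanceAs (IsProbabilityMeasure AddCircle.haarAddCircle)

/-- The projection of `ℝ³` onto the torus. -/
noncomputable def torusMk (p : ℝ × ℝ × ℝ) : UnitAddTorus (Fin 3) :=
  ![(p.1 : UnitAddCircle), (p.2.1 : UnitAddCircle), (p.2.2 : UnitAddCircle)]

/-- The representative in `[0,1)` of a point of the circle. -/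
noncomputable def unitRep (t : UnitAddCircle) : ℝ :=
  ((AddCircle.equivIco (1 : ℝ) 0 t : Set.Ico (0 : ℝ) (0 + 1)) : ℝ)

lemma measurable_unitRep : Measurable unitRep :=
  measurable_subtype_coe.comp (AddCircle.measurableEquivIco (1 : ℝ) 0).measurable_toFun

lemma unitRep_coe {x : ℝ} (hx : x ∈ Set.Ico (0 : ℝ) 1) : unitRep (x : UnitAddCircle) = x := by
  rw [unitRep, AddCircle.coe_equivIco_mk_apply]
  simpa using Int.fract_eq_self.mpr hx

/-- The representative in `[0,1)³` of a point of the torus. -/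
noncomputable def torusRep (t : UnitAddTorus (Fin 3)) : ℝ × ℝ × ℝ :=
  (unitRep (t 0), unitRep (t 1), unitRep (t 2))

lemma measurePreserving_unit_mk :
    MeasurePreserving (fun x : ℝ => (x : UnitAddCircle)) unitMeasure volume := by
  have h := UnitAddCircle.measurePreserving_mk 0
  have h1 : (AddCircle.measureSpace (1 : ℝ)).volume = AddCircle.haarAddCircle := by
    rw [AddCircle.volume_eq_smul_haarAddCircle]; simp
  rw [zero_add, ← restrict_Ico_eq_restrict_Ioc] at h
  rw [h1] at h
  exact h

lemma measurePreserving_torusMk : MeasurePreserving torusMk cubeMeasure volume := by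
  have hm : Measurable torusMk := by
    refine measurable_pi_iff.mpr fun i => ?_
    have h0 : Measurable fun x : ℝ => (x : UnitAddCircle) := measurePreserving_unit_mk.measurable
    fin_cases i
    · exact h0.comp measurable_fst
    · exact h0.comp (measurable_fst.comp measurable_snd)
    · exact h0.comp (measurable_snd.comp measurable_snd)
  refine ⟨hm, (Measure.pi_eq fun s hs => ?_).symm⟩
  rw [Measure.map_apply hm (MeasurableSet.univ_pi hs)]
  have : torusMk ⁻¹' Set.univ.pi s = ((fun x : ℝ => (x : UnitAddCircle)) ⁻¹' s 0) ×ˢ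
      (((fun x : ℝ => (x : UnitAddCircle)) ⁻¹' s 1) ×ˢ
        ((fun x : ℝ => (x : UnitAddCircle)) ⁻¹' s 2)) := by
    ext p
    simp [torusMk, Set.mem_pi, Fin.forall_fin_succ]
  rw [this, cubeMeasure, Measure.prod_prod, Measure.prod_prod,
    measurePreserving_unit_mk.measure_preimage (hs 0).nullMeasurableSet,
    measurePreserving_unit_mk.measure_preimage (hs 1).nullMeasurableSet,
    measurePreserving_unit_mk.measure_preimage (hs 2).nullMeasurableSet, Fin.prod_univ_three,
    mul_assoc]

lemma torusRep_torusMk {p : ℝ × ℝ × ℝ}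
    (hp : p.1 ∈ Set.Ico (0 : ℝ) 1 ∧ p.2.1 ∈ Set.Ico (0 : ℝ) 1 ∧ p.2.2 ∈ Set.Ico (0 : ℝ) 1) :
    torusRep (torusMk p) = p := by
  obtain ⟨h1, h2, h3⟩ := hp
  exact Prod.ext (unitRep_coe h1) (Prod.ext (unitRep_coe h2) (unitRep_coe h3))

lemma measurePreserving_torusRep : MeasurePreserving torusRep volume cubeMeasure := by
  have hm : Measurable torusRep := by
    have h (i : Fin 3) : Measurable fun t : UnitAddTorus (Fin 3) => unitRep (t i) :=
      measurable_unitRep.comp (measurable_pi_apply i)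
    exact (h 0).prodMk ((h 1).prodMk (h 2))
  refine ⟨hm, ?_⟩
  rw [← measurePreserving_torusMk.map_eq,
    Measure.map_map hm measurePreserving_torusMk.measurable]
  have : torusRep ∘ torusMk =ᵐ[cubeMeasure] id := by
    filter_upwards [ae_mem_cube] with p hp using torusRep_torusMk hp
  rw [Measure.map_congr this, Measure.map_id]

/-- A square integrable function on the cube whose Fourier coefficients all vanish is zero. -/
lemma ae_eq_zero_of_cube_fourier {g : ℝ × ℝ × ℝ → ℂ} (hg : MemLp g 2 cubeMeasure)
    (h : ∀ n k l : ℤ, ∫ p, Complex.exp (-(2 * Real.pi * Complex.I *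
      (n * p.1 + k * p.2.1 + l * p.2.2))) * g p ∂cubeMeasure = 0) : g =ᵐ[cubeMeasure] 0 := by
  -- Transport `g` to the torus, where the trigonometric system is a Hilbert basis; its coefficients
  -- are pulled back to the cube, on which `torusRep ∘ torusMk` is the identity almost everywhere.
  have hg' : MemLp (g ∘ torusRep) 2 (volume : Measure (UnitAddTorus (Fin 3))) :=
    hg.comp_measurePreserving measurePreserving_torusRep
  have hzero : hg'.toLp _ = 0 := by
    refine (UnitAddTorus.mFourierBasis (d := Fin 3)).repr.injective ?_
    rw [map_zero]
    ext i
    rw [UnitAddTorus.mFourierBasis_repr, UnitAddTorus.mFourierCoeff]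
    have e1 : ∫ t, UnitAddTorus.mFourier (-i) t • (hg'.toLp _ : UnitAddTorus (Fin 3) → ℂ) t =
        ∫ t, UnitAddTorus.mFourier (-i) t • g (torusRep t) := by
      refine integral_congr_ae ?_
      filter_upwards [hg'.coeFn_toLp] with t ht
      rw [ht]; rfl
    have hm : AEStronglyMeasurable (fun t => UnitAddTorus.mFourier (-i) t • g (torusRep t))
        (volume : Measure (UnitAddTorus (Fin 3))) :=
      (UnitAddTorus.mFourier (-i)).continuous.aestronglyMeasurable.smul hg'.aestronglyMeasurable
    rw [e1]
    rw [← measurePreserving_torusMk.map_eq] at hm ⊢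
    rw [integral_map measurePreserving_torusMk.measurable.aemeasurable hm]
    rw [lp.coeFn_zero, Pi.zero_apply, ← h (i 0) (i 1) (i 2)]
    refine integral_congr_ae ?_
    filter_upwards [ae_mem_cube] with p hp
    rw [torusRep_torusMk hp, smul_eq_mul]
    congr 1
    simp only [UnitAddTorus.mFourier, ContinuousMap.coe_mk, Fin.prod_univ_three, torusMk]
    simp only [Matrix.cons_val, fourier_coe_apply, ← Complex.exp_add]
    congr 1
    simp
    ring
  have h0 : g ∘ torusRep =ᵐ[volume] 0 := by
    have := hg'.coeFn_toLp
    rw [hzero] at this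
    exact this.symm.trans (Lp.coeFn_zero _ _ _)
  have h1 := measurePreserving_torusMk.quasiMeasurePreserving.ae_eq_comp h0
  filter_upwards [h1, ae_mem_cube] with p hp hp'
  simpa [torusRep_torusMk hp'] using hp

end Torus

/-! ### Characters of `ℤ/λℤ` -/

/-- The character `k ↦ e^{2πi q k/λ}` of `ℤ/λℤ`. -/
noncomputable def residueChar (lam q k : ℤ) : ℂ :=
  Complex.exp (2 * Real.pi * Complex.I * q * (k / lam))

lemma residueChar_add_mul {lam : ℤ} (hlam : lam ≠ 0) (q k m : ℤ) :
    residueChar lam q (k + lam * m) = residueChar lam q k := by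
  have hl : (lam : ℂ) ≠ 0 := by exact_mod_cast hlam
  refine Complex.exp_eq_exp_iff_exists_int.mpr ⟨q * m, ?_⟩
  push_cast
  field_simp

lemma conj_residueChar (lam q k : ℤ) : conj (residueChar lam q k) = residueChar lam (-q) k := by
  rw [residueChar, residueChar, ← Complex.exp_conj]
  congr 1
  simp [Complex.conj_ofNat]

lemma residueChar_mul (lam q q' k : ℤ) :
    residueChar lam q k * residueChar lam q' k = residueChar lam (q + q') k := by
  rw [residueChar, residueChar, residueChar, ← Complex.exp_add]
  congr 1; push_cast; ring

lemma residueChar_symm (lam q k : ℤ) : residueChar lam q k = residueChar lam k q := by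
  rw [residueChar, residueChar]; congr 1; ring

/-- A geometric sum with ratio `e^{2πij/λ}`, which equals `1` exactly when `λ` divides `j`. -/
lemma sum_residueChar {lam : ℤ} (hlam : lam ≠ 0) (j : ℤ) :
    ∑ r : Fin lam.natAbs, residueChar lam j r = if lam ∣ j then (lam.natAbs : ℂ) else 0 := by
  have hl : (lam : ℂ) ≠ 0 := by exact_mod_cast hlam
  have hpow : ∀ r : ℕ, residueChar lam j r = residueChar lam j 1 ^ r := by
    intro r
    rw [residueChar, residueChar, ← Complex.exp_nat_mul]
    congr 1; push_cast; ring
  have hone : residueChar lam j 1 = 1 ↔ lam ∣ j := by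
    rw [residueChar, Complex.exp_eq_one_iff]
    constructor
    · rintro ⟨n, hn⟩
      refine ⟨n, ?_⟩
      have h2 : (2 * Real.pi * Complex.I : ℂ) ≠ 0 := Complex.two_pi_I_ne_zero
      have h3 : (2 * Real.pi * Complex.I : ℂ) * (j - lam * n) = 0 := by
        push_cast at hn
        field_simp at hn
        rw [show (j : ℂ) = lam * n by linear_combination hn]; ring
      have h4 := (mul_eq_zero.mp h3).resolve_left h2
      have : (j : ℂ) = ((lam * n : ℤ) : ℂ) := by push_cast; linear_combination h4
      exact_mod_cast this
    · rintro ⟨n, rfl⟩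
      refine ⟨n, ?_⟩
      push_cast; field_simp
  rw [Fin.sum_univ_eq_sum_range (fun r : ℕ => residueChar lam j r) lam.natAbs]
  simp_rw [hpow]
  split_ifs with h
  · simp [hone.mpr h]
  · have hne : residueChar lam j 1 ≠ 1 := fun h' => h (hone.mp h')
    rw [geom_sum_eq hne, ← hpow]
    have : residueChar lam j (lam.natAbs : ℤ) = 1 := by
      obtain ⟨s, hs⟩ : lam ∣ (lam.natAbs : ℤ) := Int.dvd_natAbs_self
      rw [hs, ← zero_add (lam * s), residueChar_add_mul hlam]
      simp [residueChar]
    rw [this, sub_self, zero_div]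

/-- Fourier inversion on `ℤ/λℤ`: multiply by the conjugate character at `s` and sum over `q`, which
leaves `|λ| D s`. -/
lemma eq_zero_of_sum_residueChar {lam : ℤ} (hlam : lam ≠ 0) {D : Fin lam.natAbs → ℂ}
    (h : ∀ q : ℤ, ∑ r : Fin lam.natAbs, residueChar lam q r * D r = 0) (s : Fin lam.natAbs) :
    D s = 0 := by
  have h1 : ∑ q : Fin lam.natAbs, residueChar lam (-(s : ℕ)) (q : ℕ) *
      ∑ r : Fin lam.natAbs, residueChar lam (q : ℕ) r * D r = 0 := by
    simp [h]
  have h2 : ∀ q r : Fin lam.natAbs, residueChar lam (-(s : ℕ)) (q : ℕ) *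
      (residueChar lam (q : ℕ) r * D r) = residueChar lam ((r : ℕ) - (s : ℕ)) (q : ℕ) * D r := by
    intro q r
    rw [← mul_assoc, residueChar_symm lam (q : ℕ) r, residueChar_mul]
    congr 2; ring
  simp_rw [Finset.mul_sum, h2] at h1
  rw [Finset.sum_comm] at h1
  simp_rw [← Finset.sum_mul, sum_residueChar hlam] at h1
  rw [Finset.sum_eq_single s] at h1
  · simpa [hlam] using h1
  · intro r _ hr
    have : ¬ lam ∣ ((r : ℕ) : ℤ) - ((s : ℕ) : ℤ) := by
      intro hd
      have h3 := Int.eq_zero_of_abs_lt_dvd (Int.natAbs_dvd.mpr hd) (by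
        have := r.2; have := s.2; rw [abs_lt]; omega)
      exact hr (Fin.ext (by omega))
    rw [if_neg this, zero_mul]
  · simp

/-- Summation over `ℤ` along the residue classes modulo `λ`. -/
lemma eq_sum_tsum_residues {lam : ℤ} (hlam : lam ≠ 0) {A : ℤ → ℂ} {S : ℂ} (h : HasSum A S) :
    S = ∑ r : Fin lam.natAbs, ∑' m : ℤ, A (r + lam * m) := by
  have : NeZero lam.natAbs := ⟨Int.natAbs_ne_zero.mpr hlam⟩
  have h1 := (Int.divModEquiv lam.natAbs).symm.hasSum_iff.mpr h
  have h2 := ((Equiv.prodComm (Fin lam.natAbs) ℤ).hasSum_iff.mpr h1)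
  have h3 := h2.tsum_eq
  rw [h2.summable.tsum_prod, tsum_fintype] at h3
  rw [← h3]
  refine Finset.sum_congr rfl fun r _ => ?_
  rcases Int.natAbs_eq lam with hl | hl
  · refine tsum_congr fun m => ?_
    simp only [Function.comp_apply, Equiv.prodComm_apply, Prod.swap_prod_mk,
      Int.divModEquiv_symm_apply]
    congr 1
    rw [← hl]; ring
  -- For negative `λ` the classes are enumerated as `r + |λ|m`; the substitution `m ↦ -m` restores
  -- `r + λm`.
  · rw [← (Equiv.neg ℤ).tsum_eq]
    refine tsum_congr fun m => ?_
    simp only [Function.comp_apply, Equiv.prodComm_apply, Prod.swap_prod_mk,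
      Int.divModEquiv_symm_apply, Equiv.neg_apply]
    congr 1
    have : (lam.natAbs : ℤ) = - lam := by omega
    rw [this]; ring

/-! ### Fourier coefficients in the variables `b` and `c` -/

/-- The Fourier coefficient of index `(k, l)` of `g(a, ·, ·)`. -/
noncomputable def fiberCoeff (g : ℝ × ℝ × ℝ → ℂ) (l k : ℤ) (a : ℝ) : ℂ :=
  ∫ z, Complex.exp (-(2 * Real.pi * Complex.I * (k * z.1 + l * z.2))) * g (a, z)
    ∂(unitMeasure.prod unitMeasure)

lemma norm_exp_neg_two_pi_I (x : ℝ) :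
    ‖Complex.exp (-(2 * Real.pi * Complex.I * x))‖ = 1 := by
  have : -(2 * Real.pi * Complex.I * x : ℂ) = ((-(2 * Real.pi * x) : ℝ) : ℂ) * Complex.I := by
    push_cast; ring
  rw [this, Complex.norm_exp_ofReal_mul_I]

lemma integrable_exp_mul {α : Type*} [MeasurableSpace α] {μ : Measure α} {g : α → ℂ}
    (hg : Integrable g μ) {φ : α → ℝ} (hφ : Measurable φ) :
    Integrable (fun x => Complex.exp (-(2 * Real.pi * Complex.I * (φ x))) * g x) μ := by
  refine hg.bdd_mul (c := 1) ?_ (ae_of_all _ fun x => (norm_exp_neg_two_pi_I _).le)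
  exact (Complex.measurable_exp.comp
    ((Complex.measurable_ofReal.comp hφ).const_mul _).neg).aestronglyMeasurable

lemma integrable_fiber_exp_mul {g : ℝ × ℝ × ℝ → ℂ} (hg : Integrable g cubeMeasure) (l k : ℤ) :
    Integrable (fun p : ℝ × ℝ × ℝ =>
      Complex.exp (-(2 * Real.pi * Complex.I * (k * p.2.1 + l * p.2.2))) * g p) cubeMeasure := by
  have := integrable_exp_mul hg (φ := fun p => k * p.2.1 + l * p.2.2) (by fun_prop)
  simpa using this

lemma integrable_fiberCoeff {g : ℝ × ℝ × ℝ → ℂ} (hg : Integrable g cubeMeasure) (l k : ℤ) :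
    Integrable (fiberCoeff g l k) unitMeasure :=
  (integrable_fiber_exp_mul hg l k).integral_prod_left

/-- The bound does not depend on `k`; this uniformity lets the coefficients be glued on the line and
integrated against a Gaussian. -/
lemma integral_norm_fiberCoeff_le {g : ℝ × ℝ × ℝ → ℂ} (hg : Integrable g cubeMeasure)
    (l k : ℤ) : ∫ a, ‖fiberCoeff g l k a‖ ∂unitMeasure ≤ ∫ p, ‖g p‖ ∂cubeMeasure := by
  rw [cubeMeasure] at hg ⊢
  rw [integral_prod _ hg.norm]
  refine integral_mono (integrable_fiberCoeff hg l k).norm hg.norm.integral_prod_left fun a => ?_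
  refine (norm_integral_le_integral_norm _).trans (le_of_eq ?_)
  congr 1; funext z
  have := norm_exp_neg_two_pi_I (k * z.1 + l * z.2)
  push_cast at this
  rw [norm_mul, this, one_mul]

/-- Integration against a function that factors as `u(a) e^{-2πi(kb + lc)}`. -/
lemma integral_cube_eq_integral_fiberCoeff {g : ℝ × ℝ × ℝ → ℂ} {u : ℝ → ℂ} (l k : ℤ)
    (h : Integrable (fun p : ℝ × ℝ × ℝ => u p.1 *
      (Complex.exp (-(2 * Real.pi * Complex.I * (k * p.2.1 + l * p.2.2))) * g p)) cubeMeasure) :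
    ∫ p, u p.1 * (Complex.exp (-(2 * Real.pi * Complex.I * (k * p.2.1 + l * p.2.2))) * g p)
      ∂cubeMeasure = ∫ a, u a * fiberCoeff g l k a ∂unitMeasure := by
  rw [cubeMeasure] at h ⊢
  rw [integral_prod _ h]
  congr 1; funext a
  rw [fiberCoeff, ← integral_const_mul]

lemma gaussTerm_eq (lam q : ℤ) (P : ℝ[X]) (k : ℤ) (p : ℝ × ℝ × ℝ) :
    gaussTerm lam q P k p = residueChar lam (-q) k *
      Complex.exp (2 * Real.pi * Complex.I * (k * p.2.1 + lam * p.2.2)) *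
      (gaussPoly (Real.pi * |(lam : ℝ)|) P (k / lam + p.1) : ℂ) := by
  simp only [gaussTerm, bwzTerm, residueChar, Heis.coord, Equiv.coe_fn_symm_mk]
  congr 3
  · push_cast; ring
  · ring

lemma conj_gaussTerm (lam q : ℤ) (P : ℝ[X]) (k : ℤ) (p : ℝ × ℝ × ℝ) :
    conj (gaussTerm lam q P k p) = residueChar lam q k *
      (gaussPoly (Real.pi * |(lam : ℝ)|) P (k / lam + p.1) : ℂ) *
      Complex.exp (-(2 * Real.pi * Complex.I * (k * p.2.1 + lam * p.2.2))) := by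
  rw [gaussTerm_eq, map_mul, map_mul, conj_residueChar, neg_neg, Complex.conj_ofReal,
    ← Complex.exp_conj, mul_right_comm]
  congr 2
  simp [Complex.conj_ofNat]

lemma continuous_gaussTerm {lam : ℤ} (hlam : lam ≠ 0) (q : ℤ) (P : ℝ[X]) (k : ℤ) :
    Continuous (gaussTerm lam q P k) :=
  continuous_iff_continuousAt.mpr fun p => (hasFDerivAt_gaussTerm hlam q P k p).continuousAt

/-- The inner product with a transform, by integration term by term. -/
lemma hasSum_integral_conj_gaussSeries {lam : ℤ} (hlam : lam ≠ 0) (q : ℤ) (P : ℝ[X])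
    {g : ℝ × ℝ × ℝ → ℂ} (hg : Integrable g cubeMeasure) :
    HasSum (fun k : ℤ => residueChar lam q k *
        ∫ a, (gaussPoly (Real.pi * |(lam : ℝ)|) P (k / lam + a) : ℂ) * fiberCoeff g lam k a
          ∂unitMeasure)
      (∫ p, conj (gaussSeries lam q P p) * g p ∂cubeMeasure) := by
  obtain ⟨K, hK0, hK⟩ := exists_norm_gaussTerm_le hlam q P 1
  have hbd : ∀ k : ℤ, ∀ᵐ p ∂cubeMeasure,
      ‖conj (gaussTerm lam q P k p)‖ ≤ K * (1 + (k : ℝ) ^ 2)⁻¹ := by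
    intro k
    filter_upwards [ae_mem_cube] with p hp
    rw [RCLike.norm_conj]
    exact hK k p (abs_le.mpr ⟨by linarith [hp.1.1], hp.1.2.le⟩)
  have hint : ∀ k : ℤ, Integrable (fun p => conj (gaussTerm lam q P k p) * g p) cubeMeasure :=
    fun k => hg.bdd_mul (Complex.continuous_conj.comp
      (continuous_gaussTerm hlam q P k)).aestronglyMeasurable (hbd k)
  have hsum : Summable fun k : ℤ => ∫ p, ‖conj (gaussTerm lam q P k p) * g p‖ ∂cubeMeasure := by
    refine Summable.of_nonneg_of_le (fun k => integral_nonneg fun p => norm_nonneg _)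
      (fun k => ?_) ((summable_inv_one_add_int_sq.mul_left K).mul_right
        (∫ p, ‖g p‖ ∂cubeMeasure))
    rw [← integral_const_mul]
    refine integral_mono_ae (hint k).norm (hg.norm.const_mul _) ?_
    filter_upwards [hbd k] with p hp
    rw [norm_mul]
    exact mul_le_mul_of_nonneg_right hp (norm_nonneg _)
  have hmain := hasSum_integral_of_summable_integral_norm hint hsum
  have hl : ∀ p, ∑' k, conj (gaussTerm lam q P k p) * g p = conj (gaussSeries lam q P p) * g p := by
    intro p
    rw [tsum_mul_right, gaussSeries, Complex.conj_tsum]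
  simp_rw [hl] at hmain
  refine hmain.congr_fun fun k => ?_
  have h1 : ∀ p : ℝ × ℝ × ℝ, conj (gaussTerm lam q P k p) * g p =
      (residueChar lam q k * (gaussPoly (Real.pi * |(lam : ℝ)|) P (k / lam + p.1) : ℂ)) *
        (Complex.exp (-(2 * Real.pi * Complex.I * (k * p.2.1 + lam * p.2.2))) * g p) := by
    intro p; rw [conj_gaussTerm]; ring
  have h2 := hint k
  simp_rw [h1] at h2 ⊢
  rw [integral_cube_eq_integral_fiberCoeff (u := fun a => residueChar lam q k *
    (gaussPoly (Real.pi * |(lam : ℝ)|) P (k / lam + a) : ℂ)) lam k h2, ← integral_const_mul]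
  simp_rw [mul_assoc]

/-- The central frequencies agree, so integrating term by term against `e^{-2πikb}` keeps only the
`k`-th term. -/
lemma fiberCoeff_gaussSeries {lam : ℤ} (hlam : lam ≠ 0) (q : ℤ) (P : ℝ[X]) (k : ℤ) (a : ℝ) :
    fiberCoeff (gaussSeries lam q P) lam k a =
      residueChar lam (-q) k * (gaussPoly (Real.pi * |(lam : ℝ)|) P (k / lam + a) : ℂ) := by
  obtain ⟨K, hK0, hK⟩ := exists_norm_gaussTerm_le hlam q P |a|
  have heq : ∀ (j : ℤ) (z : ℝ × ℝ),
      Complex.exp (-(2 * Real.pi * Complex.I * (k * z.1 + lam * z.2))) * gaussTerm lam q P j (a, z)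
      = (residueChar lam (-q) j * (gaussPoly (Real.pi * |(lam : ℝ)|) P (j / lam + a) : ℂ)) *
        Complex.exp (2 * Real.pi * Complex.I * (j - k : ℤ) * z.1) := by
    intro j z
    rw [gaussTerm_eq]
    have : Complex.exp (2 * Real.pi * Complex.I * (j - k : ℤ) * z.1) =
        Complex.exp (-(2 * Real.pi * Complex.I * (k * z.1 + lam * z.2))) *
          Complex.exp (2 * Real.pi * Complex.I * (j * z.1 + lam * z.2)) := by
      rw [← Complex.exp_add]; congr 1; push_cast; ring
    rw [this]; ring
  have hnorm : ∀ (j : ℤ) (z : ℝ × ℝ), ‖Complex.exp (-(2 * Real.pi * Complex.I *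
      (k * z.1 + lam * z.2))) * gaussTerm lam q P j (a, z)‖ ≤ K * (1 + (j : ℝ) ^ 2)⁻¹ := by
    intro j z
    have := norm_exp_neg_two_pi_I (k * z.1 + lam * z.2)
    push_cast at this
    rw [norm_mul, this, one_mul]
    exact hK j _ le_rfl
  have hint : ∀ j : ℤ, Integrable (fun z : ℝ × ℝ =>
      Complex.exp (-(2 * Real.pi * Complex.I * (k * z.1 + lam * z.2))) *
        gaussTerm lam q P j (a, z)) (unitMeasure.prod unitMeasure) := by
    intro j
    have hc := continuous_gaussTerm hlam q P j
    refine (integrable_const (K * (1 + (j : ℝ) ^ 2)⁻¹)).mono' ?_ (ae_of_all _ (hnorm j))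
    exact (by fun_prop : Continuous fun z : ℝ × ℝ =>
      Complex.exp (-(2 * Real.pi * Complex.I * (k * z.1 + lam * z.2))) *
        gaussTerm lam q P j (a, z)).aestronglyMeasurable
  have hsum : Summable fun j : ℤ => ∫ z, ‖Complex.exp (-(2 * Real.pi * Complex.I *
      (k * z.1 + lam * z.2))) * gaussTerm lam q P j (a, z)‖ ∂(unitMeasure.prod unitMeasure) := by
    refine Summable.of_nonneg_of_le (fun k => integral_nonneg fun p => norm_nonneg _)
      (fun j => ?_) (summable_inv_one_add_int_sq.mul_left K)
    refine (integral_mono (hint j).norm (integrable_const _) (hnorm j)).trans ?_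
    simp
  have hval : ∀ j : ℤ, ∫ z, Complex.exp (-(2 * Real.pi * Complex.I *
      (k * z.1 + lam * z.2))) * gaussTerm lam q P j (a, z) ∂(unitMeasure.prod unitMeasure) =
      if j = k then
        residueChar lam (-q) k * (gaussPoly (Real.pi * |(lam : ℝ)|) P (k / lam + a) : ℂ) else 0 := by
    intro j
    simp_rw [heq]
    have := integral_prod_mul (μ := unitMeasure) (ν := unitMeasure)
      (fun b : ℝ => Complex.exp (2 * Real.pi * Complex.I * (j - k : ℤ) * b)) (fun _ : ℝ => (1 : ℂ))
    simp only [mul_one] at this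
    rw [integral_const_mul, this, integral_unit_exp]
    by_cases h : j = k
    · subst h; simp
    · simp [h, sub_ne_zero.mpr h]
  have hmain := hasSum_integral_of_summable_integral_norm hint hsum
  simp_rw [hval, tsum_mul_left] at hmain
  exact hmain.unique (hasSum_ite_eq k _)

lemma integral_unit_eq {E : Type*} [NormedAddCommGroup E] [NormedSpace ℝ E] (f : ℝ → E) :
    ∫ x in (0 : ℝ)..1, f x = ∫ x, f x ∂unitMeasure := by
  rw [intervalIntegral.integral_of_le zero_le_one, unitMeasure, restrict_Ico_eq_restrict_Ioc]

lemma ae_unit_mem : ∀ᵐ a ∂unitMeasure, a ∈ Set.Ico (0 : ℝ) 1 := ae_restrict_mem measurableSet_Ico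

/-! ### Orthonormality of the functions `h_{λ,q,ℓ}` -/

lemma continuous_gaussSeries {lam : ℤ} (hlam : lam ≠ 0) (q : ℤ) (P : ℝ[X]) :
    Continuous (gaussSeries lam q P) := (contDiff_gaussSeries hlam q P).continuous

lemma integrable_gaussSeries {lam : ℤ} (hlam : lam ≠ 0) (q : ℤ) (P : ℝ[X]) :
    Integrable (gaussSeries lam q P) cubeMeasure := by
  obtain ⟨K, hK⟩ := ((isCompact_Icc (a := (0 : ℝ)) (b := 1)).prod
    ((isCompact_Icc (a := (0 : ℝ)) (b := 1)).prod (isCompact_Icc (a := (0 : ℝ)) (b := 1)))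
    ).exists_bound_of_continuousOn (continuous_gaussSeries hlam q P).continuousOn
  refine (integrable_const K).mono' (continuous_gaussSeries hlam q P).aestronglyMeasurable ?_
  filter_upwards [ae_mem_cube] with p hp
  exact hK p ⟨Set.Ico_subset_Icc_self hp.1, Set.Ico_subset_Icc_self hp.2.1,
    Set.Ico_subset_Icc_self hp.2.2⟩

/-- Within a residue class the unit intervals `r/λ + m + [0,1)` tile the line, so every class
contributes the same integral over `ℝ`, weighted by the character of `q - q'`; summing over classes
gives `|λ|` or zero. -/
lemma integral_conj_gaussSeries_mul {lam : ℤ} (hlam : lam ≠ 0) (q q' : ℤ) (P P' : ℝ[X])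
    (hint : Integrable fun u => gaussPoly (Real.pi * |(lam : ℝ)|) P u *
      gaussPoly (Real.pi * |(lam : ℝ)|) P' u) :
    ∫ p, conj (gaussSeries lam q P p) * gaussSeries lam q' P' p ∂cubeMeasure =
      (if lam ∣ q - q' then (lam.natAbs : ℂ) else 0) *
        ((∫ u, gaussPoly (Real.pi * |(lam : ℝ)|) P u * gaussPoly (Real.pi * |(lam : ℝ)|) P' u : ℝ) :
          ℂ) := by
  have hl : (lam : ℝ) ≠ 0 := by exact_mod_cast hlam
  set φ : ℝ → ℂ := fun u => ((gaussPoly (Real.pi * |(lam : ℝ)|) P u *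
    gaussPoly (Real.pi * |(lam : ℝ)|) P' u : ℝ) : ℂ) with hφ
  have hφi : Integrable φ := hint.ofReal
  rw [eq_sum_tsum_residues hlam
    (hasSum_integral_conj_gaussSeries hlam q P (integrable_gaussSeries hlam q' P'))]
  have hterm : ∀ k : ℤ, residueChar lam q k *
      ∫ a, (gaussPoly (Real.pi * |(lam : ℝ)|) P (k / lam + a) : ℂ) *
        fiberCoeff (gaussSeries lam q' P') lam k a ∂unitMeasure =
      residueChar lam (q - q') k * ∫ a, φ (k / lam + a) ∂unitMeasure := by
    intro k
    simp_rw [fiberCoeff_gaussSeries hlam]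
    rw [sub_eq_add_neg, ← residueChar_mul, mul_assoc, ← integral_const_mul (residueChar lam (-q') k)]
    congr 2; funext a
    simp only [hφ]; push_cast; ring
  have hinner : ∀ r : Fin lam.natAbs, ∑' m : ℤ, residueChar lam q (r + lam * m) *
      ∫ a, (gaussPoly (Real.pi * |(lam : ℝ)|) P (((r : ℤ) + lam * m : ℤ) / lam + a) : ℂ) *
        fiberCoeff (gaussSeries lam q' P') lam (r + lam * m) a ∂unitMeasure =
      residueChar lam (q - q') r * ∫ u, φ u := by
    intro r
    simp_rw [hterm, residueChar_add_mul hlam, tsum_mul_left]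
    congr 1
    have h1 := (hφi.comp_add_left ((r : ℝ) / lam)).hasSum_intervalIntegral_comp_add_int
    rw [integral_add_left_eq_self (f := φ)] at h1
    rw [← h1.tsum_eq]
    refine tsum_congr fun m => ?_
    rw [integral_unit_eq]
    congr 1; funext a
    congr 1
    push_cast; field_simp; ring
  simp_rw [hinner]
  rw [← Finset.sum_mul, sum_residueChar hlam]
  congr 1
  exact integral_ofReal

/-- The functions `h_{λ,q,ℓ}` in `L²(M)`. -/
noncomputable def hLp {lam : ℤ} (hlam : lam ≠ 0) (q : ZModInt lam) (l : ℕ) : L2M :=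
  (memLp_of_isSmooth (isSmooth_hFun hlam q l)).toLp _

lemma coeFn_hLp {lam : ℤ} (hlam : lam ≠ 0) (q : ZModInt lam) (l : ℕ) :
    hLp hlam q l =ᵐ[nilMeasure] hFun lam q l := MemLp.coeFn_toLp _

/-- The characters in `L²(M)`. -/
noncomputable def chiLp (ω : ℤ × ℤ) : L2M := (memLp_of_isSmooth (isSmooth_chi ω)).toLp _

lemma coeFn_chiLp (ω : ℤ × ℤ) : chiLp ω =ᵐ[nilMeasure] chi ω := MemLp.coeFn_toLp _

lemma hFun_coordProj (lam q : ℤ) (l : ℕ) (p : ℝ × ℝ × ℝ) :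
    hFun lam (QuotientAddGroup.mk q) l (coordProj p) =
      ((√|(lam : ℝ)| / (lam : ℝ) : ℝ) : ℂ) * gaussSeries lam q (scaledHermitePoly l lam) p := by
  rw [hFun_mk]; rfl

lemma inner_hLp {lam : ℤ} (hlam : lam ≠ 0) (q q' : ZModInt lam) (l l' : ℕ) :
    inner ℂ (hLp hlam q l) (hLp hlam q' l') = if (q, l) = (q', l') then 1 else 0 := by
  have hl : (lam : ℝ) ≠ 0 := by exact_mod_cast hlam
  rw [inner_eq_integral_cube (coeFn_hLp hlam q l) (coeFn_hLp hlam q' l')]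
  obtain ⟨q, rfl⟩ := QuotientAddGroup.mk_surjective q
  obtain ⟨q', rfl⟩ := QuotientAddGroup.mk_surjective q'
  simp_rw [hFun_coordProj]
  have h1 : ∀ p, conj (((√|(lam : ℝ)| / (lam : ℝ) : ℝ) : ℂ) *
      gaussSeries lam q (scaledHermitePoly l lam) p) * (((√|(lam : ℝ)| / (lam : ℝ) : ℝ) : ℂ) *
      gaussSeries lam q' (scaledHermitePoly l' lam) p) =
      ((1 / |(lam : ℝ)| : ℝ) : ℂ) * (conj (gaussSeries lam q (scaledHermitePoly l lam) p) *
        gaussSeries lam q' (scaledHermitePoly l' lam) p) := by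
    intro p
    -- The square of the normalising factor `√|λ|/λ` is `1/|λ|`, which cancels the number of residue
    -- classes.
    have h2 : (1 / |(lam : ℝ)| : ℝ) = (√|(lam : ℝ)| / lam) * (√|(lam : ℝ)| / lam) := by
      rw [div_mul_div_comm, Real.mul_self_sqrt (abs_nonneg _), ← abs_mul_abs_self (lam : ℝ)]
      field_simp
    rw [h2, map_mul, Complex.conj_ofReal]
    push_cast; ring
  simp_rw [h1]
  have horth := integral_hermiteScaled_mul hl l l'
  simp_rw [hermiteScaled_eq] at horth
  have hint : Integrable fun u =>
      gaussPoly (Real.pi * |(lam : ℝ)|) (scaledHermitePoly l lam) u *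
        gaussPoly (Real.pi * |(lam : ℝ)|) (scaledHermitePoly l' lam) u := by
    have hα : 0 < Real.pi * |(lam : ℝ)| := by positivity
    obtain ⟨K, hK⟩ := exists_abs_gaussPoly_le hα (scaledHermitePoly l lam)
    exact (integrable_gaussPoly hα _).bdd_mul
      (continuous_gaussPoly _ _).aestronglyMeasurable (ae_of_all _ hK)
  rw [integral_const_mul, integral_conj_gaussSeries_mul hlam q q' _ _ hint, horth]
  have hiff : ((q : ZModInt lam) = (q' : ZModInt lam)) ↔ lam ∣ q - q' := by
    rw [QuotientAddGroup.eq, AddSubgroup.mem_zmultiples_iff]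
    constructor
    · rintro ⟨j, hj⟩
      exact ⟨-j, by rw [smul_eq_mul] at hj; linear_combination hj⟩
    · rintro ⟨j, hj⟩
      exact ⟨-j, by rw [smul_eq_mul]; linear_combination hj⟩
  have hn : ((lam.natAbs : ℕ) : ℂ) = ((|(lam : ℝ)| : ℝ) : ℂ) := by
    rw [← Int.cast_abs, Int.abs_eq_natAbs, Int.cast_natCast, Complex.ofReal_natCast]
  have hn0 : ((|(lam : ℝ)| : ℝ) : ℂ) ≠ 0 := by exact_mod_cast abs_ne_zero.mpr hl
  by_cases hq : lam ∣ q - q'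
  · by_cases hll : l = l'
    · rw [if_pos hq, if_pos hll, if_pos (Prod.ext (hiff.mpr hq) hll), hn]
      push_cast
      field_simp
    · have : ¬ (((q : ZModInt lam), l) = ((q' : ZModInt lam), l')) := fun h =>
        hll (congrArg Prod.snd h)
      rw [if_neg hll, if_neg this]; simp
  · have : ¬ (((q : ZModInt lam), l) = ((q' : ZModInt lam), l')) := fun h =>
      hq (hiff.mp (congrArg Prod.fst h))
    rw [if_neg hq, if_neg this]; simp

lemma inner_chiLp_eq (ω : ℤ × ℤ) (f : L2M) : inner ℂ (chiLp ω) f =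
    ∫ p, Complex.exp (-(2 * Real.pi * Complex.I *
      (ω.1 * p.1 + ω.2 * p.2.1))) * f (coordProj p) ∂cubeMeasure := by
  rw [inner_eq_integral_cube (coeFn_chiLp ω) (Filter.EventuallyEq.refl _ f)]
  congr 1; funext p
  congr 1
  change conj (Complex.exp (2 * Real.pi * Complex.I * (ω.1 * p.1 + ω.2 * p.2.1))) = _
  rw [← Complex.exp_conj]
  congr 1
  simp [Complex.conj_ofNat]

lemma inner_chiLp (ω ω' : ℤ × ℤ) :
    inner ℂ (chiLp ω) (chiLp ω') = if ω = ω' then 1 else 0 := by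
  rw [inner_eq_integral_cube (coeFn_chiLp ω) (coeFn_chiLp ω')]
  have h1 : ∀ p : ℝ × ℝ × ℝ, conj (chi ω (coordProj p)) * chi ω' (coordProj p) =
      Complex.exp (2 * Real.pi * Complex.I * (ω'.1 - ω.1 : ℤ) * p.1) *
        Complex.exp (2 * Real.pi * Complex.I * (ω'.2 - ω.2 : ℤ) * p.2.1) := by
    intro p
    change conj (Complex.exp (2 * Real.pi * Complex.I * (ω.1 * p.1 + ω.2 * p.2.1))) *
      Complex.exp (2 * Real.pi * Complex.I * (ω'.1 * p.1 + ω'.2 * p.2.1)) = _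
    rw [← Complex.exp_conj, ← Complex.exp_add, ← Complex.exp_add]
    congr 1
    simp [Complex.conj_ofNat]
    ring
  simp_rw [h1]
  have h2 := integral_cube_mul (fun z => Complex.exp (2 * Real.pi * Complex.I *
    (ω'.1 - ω.1 : ℤ) * z.1) * Complex.exp (2 * Real.pi * Complex.I * (ω'.2 - ω.2 : ℤ) * z.2))
    (fun _ => 1)
  have h3 := integral_prod_mul (μ := unitMeasure) (ν := unitMeasure)
    (fun a : ℝ => Complex.exp (2 * Real.pi * Complex.I * (ω'.1 - ω.1 : ℤ) * a))
    (fun b : ℝ => Complex.exp (2 * Real.pi * Complex.I * (ω'.2 - ω.2 : ℤ) * b))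
  rw [h3, integral_unit_exp, integral_unit_exp] at h2
  simp only [mul_one] at h2
  rw [h2]
  have hiff : ω = ω' ↔ (ω'.1 - ω.1 = 0 ∧ ω'.2 - ω.2 = 0) := by
    rw [Prod.ext_iff, sub_eq_zero, sub_eq_zero, eq_comm, @eq_comm _ ω.2]
  by_cases ha : ω'.1 - ω.1 = 0 <;> by_cases hb : ω'.2 - ω.2 = 0 <;> simp [hiff, ha, hb]

/-! ### Completeness -/

/-- If the functions `e m` are uniformly integrable on `[0,1)`, the function on the line that is
`e m` on `[m, m + 1)` becomes integrable after multiplication by a Gaussian. -/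
lemma integrable_gaussPoly_mul_glue {e : ℤ → ℝ → ℂ} {K : ℝ}
    (hi : ∀ m, Integrable (e m) unitMeasure) (hK : ∀ m, ∫ a, ‖e m a‖ ∂unitMeasure ≤ K)
    {α : ℝ} (hα : 0 < α) (P : ℝ[X]) (t : ℝ) :
    Integrable fun u : ℝ => (gaussPoly α P (t + u) : ℂ) * e ⌊u⌋ (Int.fract u) := by
  -- The shift bound is used with `lam = 1`: on `[m, m + 1)` the argument is `m + (t + a)` with `|t
  -- + a| ≤ |t| + 1`.
  obtain ⟨B, hB0, hB⟩ := exists_abs_gaussPoly_shift_le hα P one_ne_zero (|t| + 1)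
  let F : ℤ → ℝ → ℂ := fun m a => (gaussPoly α P (m / 1 + (t + a)) : ℂ) * e m a
  have hbd : ∀ m : ℤ, ∀ᵐ a ∂unitMeasure,
      ‖(gaussPoly α P (m / 1 + (t + a)) : ℂ)‖ ≤ B * (1 + (m : ℝ) ^ 2)⁻¹ := by
    intro m
    filter_upwards [ae_unit_mem] with a ha
    rw [Complex.norm_real]
    refine hB m _ ((abs_add_le _ _).trans ?_)
    have : |a| ≤ 1 := abs_le.mpr ⟨by linarith [ha.1], ha.2.le⟩
    linarith
  have hFi : ∀ m, Integrable (F m) unitMeasure := fun m => (hi m).bdd_mul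
    (Complex.continuous_ofReal.comp ((continuous_gaussPoly α P).comp
      (by fun_prop))).aestronglyMeasurable (hbd m)
  have hFn : ∀ m, ∫ a, ‖F m a‖ ∂unitMeasure ≤ B * K * (1 + (m : ℝ) ^ 2)⁻¹ := by
    intro m
    have : ∫ a, ‖F m a‖ ∂unitMeasure ≤
        ∫ a, B * (1 + (m : ℝ) ^ 2)⁻¹ * ‖e m a‖ ∂unitMeasure := by
      refine integral_mono_ae (hFi m).norm ((hi m).norm.const_mul _) ?_
      filter_upwards [hbd m] with a ha
      rw [norm_mul]
      exact mul_le_mul_of_nonneg_right ha (norm_nonneg _)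
    refine this.trans ?_
    rw [integral_const_mul]
    have h2 : 0 ≤ B * (1 + (m : ℝ) ^ 2)⁻¹ := by positivity
    nlinarith [mul_le_mul_of_nonneg_left (hK m) h2]
  have hpre : ∀ m : ℤ, (fun u : ℝ => u - m) ⁻¹' Set.Ico (0 : ℝ) 1 = Set.Ico (m : ℝ) (m + 1) := by
    intro m; rw [Set.preimage_sub_const_Ico, zero_add, add_comm]
  have hmp : ∀ m : ℤ, MeasurePreserving (fun u : ℝ => u - m) volume volume := fun m =>
    measurePreserving_sub_right volume (m : ℝ)
  have hemb : ∀ m : ℤ, MeasurableEmbedding (fun u : ℝ => u - (m : ℝ)) := fun m =>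
    (MeasurableEquiv.subRight (m : ℝ)).measurableEmbedding
  have heq : ∀ m : ℤ, Set.EqOn (F m ∘ fun u : ℝ => u - m)
      (fun u : ℝ => (gaussPoly α P (t + u) : ℂ) * e ⌊u⌋ (Int.fract u))
      (Set.Ico (m : ℝ) (m + 1)) := by
    intro m u hu
    have hf : ⌊u⌋ = m := Int.floor_eq_iff.mpr hu
    simp only [F, Function.comp_apply, Int.fract, hf]
    congr 3; ring
  rw [← integrableOn_univ, ← iUnion_Ico_intCast]
  refine integrableOn_iUnion_of_summable_integral_norm (fun m => ?_) ?_
  · refine IntegrableOn.congr_fun ?_ (heq m) measurableSet_Ico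
    rw [← hpre m, (hmp m).integrableOn_comp_preimage (hemb m)]
    exact hFi m
  · refine Summable.of_nonneg_of_le (fun m => integral_nonneg fun u => norm_nonneg _)
      (fun m => ?_) (summable_inv_one_add_int_sq.mul_left (B * K))
    refine le_trans (le_of_eq ?_) (hFn m)
    rw [← setIntegral_congr_fun measurableSet_Ico fun u hu => congrArg norm (heq m hu), ← hpre m]
    exact (hmp m).setIntegral_preimage_emb (hemb m) (fun a => ‖F m a‖) _

/-- If `g` is orthogonal to all `h_{λ,q,ℓ}`, its Fourier coefficients of index `(k, λ)` in the
variables `(b, c)` vanish. -/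
lemma fiberCoeff_ae_eq_zero {lam : ℤ} (hlam : lam ≠ 0) {g : ℝ × ℝ × ℝ → ℂ}
    (hg : Integrable g cubeMeasure)
    (h : ∀ (q : ℤ) (l : ℕ), ∫ p, conj (gaussSeries lam q (scaledHermitePoly l lam) p) * g p
      ∂cubeMeasure = 0) (k : ℤ) : ∀ᵐ a ∂unitMeasure, fiberCoeff g lam k a = 0 := by
  have hl : (lam : ℝ) ≠ 0 := by exact_mod_cast hlam
  have hα : 0 < Real.pi * |(lam : ℝ)| := by positivity
  -- The coefficients of the class of `r`, glued to one function on the line: on `[m, m + 1)` it is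
  -- the coefficient of index `r + λm`.
  let c : ℤ → ℝ → ℂ := fun r u => fiberCoeff g lam (r + lam * ⌊u⌋) (Int.fract u)
  have hci : ∀ (r : ℤ) {β : ℝ}, 0 < β → ∀ P : ℝ[X],
      Integrable fun u => (gaussPoly β P (r / lam + u) : ℂ) * c r u := fun r β hβ P =>
    integrable_gaussPoly_mul_glue (e := fun m => fiberCoeff g lam (r + lam * m))
      (fun m => integrable_fiberCoeff hg lam _) (fun m => integral_norm_fiberCoeff_le hg lam _)
      hβ P (r / lam)
  have hcm : ∀ (r m : ℤ) {a : ℝ}, a ∈ Set.Ico (0 : ℝ) 1 →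
      c r (a + m) = fiberCoeff g lam (r + lam * m) a := by
    intro r m a ha
    have h1 : ⌊a + m⌋ = m := by rw [Int.floor_add_intCast, Int.floor_eq_zero_iff.mpr ha, zero_add]
    have h2 : Int.fract (a + m) = a := by rw [Int.fract_add_intCast, Int.fract_eq_self.mpr ha]
    simp only [c, h1, h2]
  have horth : ∀ (r : Fin lam.natAbs) (l : ℕ),
      ∫ u, (gaussPoly (Real.pi * |(lam : ℝ)|) (scaledHermitePoly l lam) ((r : ℤ) / lam + u) : ℂ) *
        c r u = 0 := by
    intro r l
    -- Orthogonality for all `q` says that a finite Fourier transform in `r` vanishes, so each class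
    -- gives zero separately.
    refine eq_zero_of_sum_residueChar hlam (D := fun r : Fin lam.natAbs => ∫ u,
      (gaussPoly (Real.pi * |(lam : ℝ)|) (scaledHermitePoly l lam) ((r : ℤ) / lam + u) : ℂ) *
        c r u) (fun q => ?_) r
    have h1 := eq_sum_tsum_residues hlam
      (hasSum_integral_conj_gaussSeries hlam q (scaledHermitePoly l lam) hg)
    rw [h q l] at h1
    rw [h1]
    refine Finset.sum_congr rfl fun r _ => ?_
    simp_rw [residueChar_add_mul hlam, tsum_mul_left]
    congr 1
    rw [← ((hci r hα (scaledHermitePoly l lam)).hasSum_intervalIntegral_comp_add_int).tsum_eq]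
    refine tsum_congr fun m => ?_
    rw [integral_unit_eq]
    refine integral_congr_ae ?_
    filter_upwards [ae_unit_mem] with a ha
    rw [hcm _ _ ha]
    congr 3
    push_cast; field_simp; ring
  have hzero : ∀ r : Fin lam.natAbs, ∀ᵐ u, c r u = 0 := by
    intro r
    -- Translation by `r/λ` recentres the profile at the origin, where completeness of the Hermite
    -- functions applies.
    have hG : ∀ᵐ u, c r (u - (r : ℤ) / lam) = 0 := by
      refine ae_eq_zero_of_integral_hermiteScaled_eq_zero (fun β hβ => ?_) hl (fun l => ?_)
      · have := (hci r hβ 1).comp_sub_right ((r : ℤ) / (lam : ℝ))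
        simpa [gaussPoly] using this
      · have h1 := horth r l
        rw [← integral_sub_right_eq_self _ (((r : ℕ) : ℤ) / (lam : ℝ))] at h1
        simpa [hermiteScaled_eq] using h1
    have h2 := (measurePreserving_add_right volume
      (((r : ℕ) : ℤ) / (lam : ℝ))).quasiMeasurePreserving.ae hG
    filter_upwards [h2] with u hu
    simpa using hu
  have hnn : 0 ≤ k % lam := Int.emod_nonneg k hlam
  have hlt : k % lam < lam.natAbs := by
    have := Int.emod_lt_abs k hlam
    rwa [Int.abs_eq_natAbs] at this
  -- The given `k` is `r + λm` with `r = k % λ` and `m = k / λ`; its coefficient is the piece of `c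
  -- r` on `[m, m + 1)`.
  let r : Fin lam.natAbs := ⟨(k % lam).toNat, by omega⟩
  have hr : ((r : ℕ) : ℤ) = k % lam := Int.toNat_of_nonneg hnn
  have h3 := (measurePreserving_add_right volume ((k / lam : ℤ) : ℝ)).quasiMeasurePreserving.ae
    (hzero r)
  have h4 : ∀ᵐ a ∂unitMeasure, c r (a + (k / lam : ℤ)) = 0 := ae_restrict_of_ae h3
  filter_upwards [h4, ae_unit_mem] with a ha ha'
  rw [hcm _ _ ha', hr, Int.emod_add_mul_ediv] at ha
  exact ha

/-- A function that is orthogonal to all characters and to all `h_{λ,q,ℓ}` is zero. -/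
lemma eq_zero_of_inner_eq_zero {f : L2M} (hchi : ∀ ω, inner ℂ (chiLp ω) f = 0)
    (hh : ∀ {lam : ℤ} (hlam : lam ≠ 0) (q : ZModInt lam) (l : ℕ),
      inner ℂ (hLp hlam q l) f = 0) : f = 0 := by
  have hg2 : MemLp (fun p => f (coordProj p)) 2 cubeMeasure :=
    (Lp.memLp f).comp_measurePreserving measurePreserving_coordProj
  have hg : Integrable (fun p => f (coordProj p)) cubeMeasure := hg2.integrable one_le_two
  have hcube : (fun p => f (coordProj p)) =ᵐ[cubeMeasure] 0 := by
    refine ae_eq_zero_of_cube_fourier hg2 fun n k l => ?_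
    -- For `l = 0` the Fourier coefficient is the inner product with a character. For `l ≠ 0` it is
    -- an integral over `a` of the coefficient of index `(k, l)`, which vanishes almost everywhere.
    rcases eq_or_ne l 0 with rfl | hl
    · have := hchi (n, k)
      rw [inner_chiLp_eq] at this
      simpa using this
    · have hfib := fiberCoeff_ae_eq_zero hl hg (fun q j => ?_) k
      · have hsplit : ∀ p : ℝ × ℝ × ℝ, Complex.exp (-(2 * Real.pi * Complex.I *
            (n * p.1 + k * p.2.1 + l * p.2.2))) * f (coordProj p) =
            Complex.exp (-(2 * Real.pi * Complex.I * (n * p.1))) *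
              (Complex.exp (-(2 * Real.pi * Complex.I * (k * p.2.1 + l * p.2.2))) *
                f (coordProj p)) := by
          intro p
          rw [← mul_assoc, ← Complex.exp_add]
          congr 2; ring
        have hint := integrable_exp_mul (integrable_fiber_exp_mul hg l k)
          (φ := fun p => n * p.1) (by fun_prop)
        push_cast at hint
        simp_rw [hsplit]
        rw [integral_cube_eq_integral_fiberCoeff
          (u := fun a => Complex.exp (-(2 * Real.pi * Complex.I * (n * a)))) l k hint]
        refine integral_eq_zero_of_ae ?_
        filter_upwards [hfib] with a ha
        rw [ha, mul_zero]; rfl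
      · have h1 := hh hl (QuotientAddGroup.mk q) j
        rw [inner_eq_integral_cube (coeFn_hLp hl _ j) (Filter.EventuallyEq.refl _ f)] at h1
        simp_rw [hFun_coordProj, map_mul, Complex.conj_ofReal, mul_assoc] at h1
        rw [integral_const_mul] at h1
        refine (mul_eq_zero.mp h1).resolve_left (Complex.ofReal_ne_zero.mpr ?_)
        have hl' : (l : ℝ) ≠ 0 := by exact_mod_cast hl
        exact div_ne_zero (Real.sqrt_ne_zero'.mpr (abs_pos.mpr hl')) hl'
  rw [← norm_eq_zero, ← sq_eq_zero_iff, norm_sq_eq_re_inner (𝕜 := ℂ),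
    inner_eq_integral_cube (Filter.EventuallyEq.refl _ f) (Filter.EventuallyEq.refl _ f)]
  rw [integral_eq_zero_of_ae]
  · simp
  · filter_upwards [hcube] with p hp
    have : f (coordProj p) = 0 := hp
    simp [this]

/-! ### The orthonormal bases -/

/-- The family of all characters and all `h_{λ,q,ℓ}` in `L²(M)`. -/
noncomputable def eigenLp : (ℤ × ℤ) ⊕ HIndex → L2M :=
  Sum.elim chiLp fun i => hLp i.1.2 i.2.1 i.2.2

lemma orthonormal_eigenLp : Orthonormal ℂ eigenLp := by
  classical
  rw [orthonormal_iff_ite]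
  have hne (ω : ℤ × ℤ) (i : HIndex) : inner ℂ (chiLp ω) (hLp i.1.2 i.2.1 i.2.2) = 0 :=
    inner_L2sub_eq_zero (Ne.symm i.1.2) (chi_mem_L2sub (coeFn_chiLp ω))
      (hFun_mem_L2sub (coeFn_hLp i.1.2 i.2.1 i.2.2))
  rintro (ω | ⟨⟨lam, hlam⟩, q, l⟩) (ω' | ⟨⟨mu, hmu⟩, q', l'⟩)
  · simp [eigenLp, inner_chiLp]
  · simpa [eigenLp] using hne ω ⟨⟨mu, hmu⟩, q', l'⟩
  · simpa [eigenLp] using inner_eq_zero_symm.mp (hne ω' ⟨⟨lam, hlam⟩, q, l⟩)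
  · by_cases h : lam = mu
    · subst h
      have := inner_hLp hlam q q' l l'
      simpa [eigenLp] using this
    · have h1 : inner ℂ (hLp hlam q l) (hLp hmu q' l') = 0 :=
        inner_L2sub_eq_zero h (hFun_mem_L2sub (coeFn_hLp hlam q l))
          (hFun_mem_L2sub (coeFn_hLp hmu q' l'))
      rw [if_neg (by simp [h])]
      exact h1

lemma span_eigenLp_orthogonal : (Submodule.span ℂ (Set.range eigenLp))ᗮ = ⊥ := by
  rw [Submodule.eq_bot_iff]
  intro f hf
  have h (i) : inner ℂ (eigenLp i) f = 0 :=
    Submodule.inner_right_of_mem_orthogonal (Submodule.subset_span (Set.mem_range_self i)) hf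
  exact eq_zero_of_inner_eq_zero (fun ω => h (Sum.inl ω))
    fun {lam} hlam q l => h (Sum.inr ⟨⟨lam, hlam⟩, q, l⟩)

/-- Orthonormal elements of `L²_λ(M)` that contain all the `eigenLp i` belonging to `L²_λ(M)` form
an orthonormal basis of it. -/
lemma exists_hilbertBasis_L2sub {ι : Type*} {lam : ℤ} {v : ι → L2M} (hv : Orthonormal ℂ v)
    (hmem : ∀ i, v i ∈ L2sub lam)
    (hrest : ∀ j, (∃ i, v i = eigenLp j) ∨ ∃ mu, mu ≠ lam ∧ eigenLp j ∈ L2sub mu) :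
    ∃ e : HilbertBasis ι ℂ (L2sub lam), ∀ i, (e i : L2M) = v i := by
  let w : ι → L2sub lam := fun i => ⟨v i, hmem i⟩
  have hw : Orthonormal ℂ w := hv.codRestrict (L2sub lam) hmem
  have hbot : (Submodule.span ℂ (Set.range w))ᗮ = ⊥ := by
    rw [Submodule.eq_bot_iff]
    rintro ⟨f, hf⟩ hf'
    have h (i) : inner ℂ (v i) f = 0 :=
      Submodule.inner_right_of_mem_orthogonal (K := Submodule.span ℂ (Set.range w))
        (u := w i) (Submodule.subset_span ⟨i, rfl⟩) hf'
    -- The members of the total family outside `v` lie in some `L²_μ(M)` with `μ ≠ λ` and are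
    -- orthogonal to `f` automatically, so `f` is orthogonal to a total family.
    have hf0 : f ∈ (Submodule.span ℂ (Set.range eigenLp))ᗮ := by
      rw [Submodule.mem_orthogonal]
      intro u hu
      suffices h' : Submodule.span ℂ (Set.range eigenLp) ≤ (Submodule.span ℂ {f})ᗮ from
        Submodule.mem_orthogonal_singleton_iff_inner_left.mp (h' hu)
      rw [Submodule.span_le]
      rintro _ ⟨j, rfl⟩
      refine Submodule.mem_orthogonal_singleton_iff_inner_left.mpr ?_
      rcases hrest j with ⟨i, hi⟩ | ⟨mu, hmu, hj⟩
      · rw [← hi]; exact h i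
      · exact inner_L2sub_eq_zero hmu hj hf
    rw [span_eigenLp_orthogonal, Submodule.mem_bot] at hf0
    exact Subtype.ext hf0
  exact ⟨HilbertBasis.mkOfOrthogonalEqBot hw hbot, fun i => by
    rw [HilbertBasis.coe_mkOfOrthogonalEqBot]⟩

lemma exists_hilbertBasis_chi : ∃ e : HilbertBasis (ℤ × ℤ) ℂ (L2sub 0),
    ∀ ω : ℤ × ℤ, ((e ω : L2M) : Nil → ℂ) =ᵐ[nilMeasure] chi ω := by
  obtain ⟨e, he⟩ := exists_hilbertBasis_L2sub
    (orthonormal_eigenLp.comp Sum.inl Sum.inl_injective)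
    (fun ω => chi_mem_L2sub (coeFn_chiLp ω)) (by
      rintro (ω | i)
      · exact Or.inl ⟨ω, rfl⟩
      · exact Or.inr ⟨i.1.1, i.1.2, hFun_mem_L2sub (coeFn_hLp i.1.2 i.2.1 i.2.2)⟩)
  exact ⟨e, fun ω => by rw [he]; exact coeFn_chiLp ω⟩

lemma exists_hilbertBasis_hFun {lam : ℤ} (hlam : lam ≠ 0) :
    ∃ e : HilbertBasis (ZModInt lam × ℕ) ℂ (L2sub lam), ∀ (q : ZModInt lam) (l : ℕ),
      ((e (q, l) : L2M) : Nil → ℂ) =ᵐ[nilMeasure] hFun lam q l := by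
  obtain ⟨e, he⟩ := exists_hilbertBasis_L2sub
    (orthonormal_eigenLp.comp (fun i : ZModInt lam × ℕ => Sum.inr (⟨⟨lam, hlam⟩, i⟩ : HIndex))
      (fun i j h => by simpa using h))
    (fun i => hFun_mem_L2sub (coeFn_hLp hlam i.1 i.2)) (by
      rintro (ω | ⟨⟨mu, hmu⟩, i⟩)
      · exact Or.inr ⟨0, hlam.symm, chi_mem_L2sub (coeFn_chiLp ω)⟩
      · by_cases h : mu = lam
        · subst h
          exact Or.inl ⟨i, rfl⟩
        · exact Or.inr ⟨mu, h, hFun_mem_L2sub (coeFn_hLp hmu i.1 i.2)⟩)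
  exact ⟨e, fun q l => by rw [he]; exact coeFn_hLp hlam q l⟩

/-- Density of the sum comes from the eigenfunctions: each lies in one of the subspaces, and
together they are total. -/
lemma isHilbertSum_L2sub :
    IsHilbertSum ℂ (fun lam : ℤ => L2sub lam) (fun lam : ℤ => (L2sub lam).subtypeₗᵢ) := by
  refine IsHilbertSum.mkInternal _ ?_ ?_
  · intro lam mu h f g
    exact inner_L2sub_eq_zero h f.2 g.2
  · rw [← Submodule.topologicalClosure_eq_top_iff.mpr span_eigenLp_orthogonal]
    refine Submodule.topologicalClosure_mono (Submodule.span_le.mpr ?_)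
    rintro _ ⟨ω | i, rfl⟩
    · exact Submodule.mem_iSup_of_mem 0 (chi_mem_L2sub (coeFn_chiLp ω))
    · exact Submodule.mem_iSup_of_mem i.1.1 (hFun_mem_L2sub (coeFn_hLp i.1.2 i.2.1 i.2.2))

end HeisenbergNil

theorem theorem3p1 :
    -- the characters are smooth, normalised eigenfunctions
    (∀ ω : ℤ × ℤ,
      IsSmooth (chi ω) ∧
      MeasureTheory.MemLp (chi ω) 2 nilMeasure ∧
      MeasureTheory.eLpNorm (chi ω) 2 nilMeasure = 1 ∧
      subLaplacian (chi ω) =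
        fun p => (((2 * Real.pi) ^ 2 * ((ω.1 : ℝ) ^ 2 + (ω.2 : ℝ) ^ 2) : ℝ) : ℂ) * chi ω p) ∧
    -- the series that define the `h_{λ,q,ℓ}` converge absolutely at every point
    (∀ lam : ℤ, lam ≠ 0 → ∀ (q : ℤ) (l : ℕ) (x : Heis),
      Summable (bwzTerm lam q (fun u => (hermiteScaled l lam u : ℂ)) x)) ∧
    -- the `h_{λ,q,ℓ}` are smooth, normalised eigenfunctions
    (∀ lam : ℤ, lam ≠ 0 → ∀ (q : ZModInt lam) (l : ℕ),
      IsSmooth (hFun lam q l) ∧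
      MeasureTheory.MemLp (hFun lam q l) 2 nilMeasure ∧
      MeasureTheory.eLpNorm (hFun lam q l) 2 nilMeasure = 1 ∧
      subLaplacian (hFun lam q l) =
        fun p => ((2 * Real.pi * |(lam : ℝ)| * (2 * (l : ℝ) + 1) : ℝ) : ℂ) * hFun lam q l p) ∧
    -- `L²(M)` is the orthogonal Hilbert sum of the `L²_λ(M)`
    IsHilbertSum ℂ (fun lam : ℤ => L2sub lam) (fun lam : ℤ => (L2sub lam).subtypeₗᵢ) ∧
    -- all these functions together form an orthonormal basis of `L²(M)`
    (∃ e : HilbertBasis ((ℤ × ℤ) ⊕ HIndex) ℂ L2M,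
      (∀ ω : ℤ × ℤ, e (Sum.inl ω) =ᵐ[nilMeasure] chi ω) ∧
      ∀ i : HIndex, e (Sum.inr i) =ᵐ[nilMeasure] hFun i.1.1 i.2.1 i.2.2) ∧
    -- the characters form an orthonormal basis of `L²_0(M)`
    (∃ e : HilbertBasis (ℤ × ℤ) ℂ (L2sub 0),
      ∀ ω : ℤ × ℤ, ((e ω : L2M) : Nil → ℂ) =ᵐ[nilMeasure] chi ω) ∧
    -- for each `λ ≠ 0` the `h_{λ,q,ℓ}` form an orthonormal basis of `L²_λ(M)`
    (∀ lam : ℤ, lam ≠ 0 → ∃ e : HilbertBasis (ZModInt lam × ℕ) ℂ (L2sub lam),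
      ∀ (q : ZModInt lam) (l : ℕ),
        ((e (q, l) : L2M) : Nil → ℂ) =ᵐ[nilMeasure] hFun lam q l) := by
  refine ⟨fun ω => ⟨isSmooth_chi ω, memLp_of_isSmooth (isSmooth_chi ω),
      eLpNorm_eq_one_of_inner _ ((inner_chiLp ω ω).trans (if_pos rfl)), subLaplacian_chi ω⟩,
    fun lam hlam q l x => summable_bwzTerm_hermiteScaled hlam q l x,
    fun lam hlam q l => ⟨isSmooth_hFun hlam q l, memLp_of_isSmooth (isSmooth_hFun hlam q l),
      eLpNorm_eq_one_of_inner _ ((inner_hLp hlam q q l l).trans (if_pos rfl)),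
      subLaplacian_hFun hlam q l⟩,
    isHilbertSum_L2sub, ?_, exists_hilbertBasis_chi,
    fun lam hlam => exists_hilbertBasis_hFun hlam⟩
  refine ⟨HilbertBasis.mkOfOrthogonalEqBot orthonormal_eigenLp span_eigenLp_orthogonal,
    fun ω => ?_, fun i => ?_⟩
  · rw [HilbertBasis.coe_mkOfOrthogonalEqBot]
    exact coeFn_chiLp ω
  · rw [HilbertBasis.coe_mkOfOrthogonalEqBot]
    exact coeFn_hLp i.1.2 i.2.1 i.2.2
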